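/- **Theorem.** Let $d\ge 0$ be an integer and let $G$ be a finite simple graph with vertex set $V$, $|V|=n$, and $m$ edges. Suppose that $G$ is $(d+1)$-connected (it has at least $d+2$ vertices and stays connected after deleting any at most $d$ vertices) and that $H$ is a $K_{d+1}$ subgraph of $G$. A *stress matrix* of a framework $(G,\mathbf p)$, $\mathbf p\in(\mathbb R^d)^V$, is a real symmetric matrix $\Omega\in\mathbb R^{V\times V}$ with $\Omega_{ij}=0$ for all distinct non-adjacent $i,j$, with zero row sums, and with $\sum_j \Omega_{ij}(\mathbf p_i-\mathbf p_j)=0$ for every $i$; the weight of an edge $ij$ is $\omega_{ij}=-\Omega_{ij}$. Let $\mathrm{Gstr}$ be the set of real symmetric $V\times V$ matrices that have zero entries at all pairs of distinct non-adjacent vertices, have the all-ones vector in the kernel, have rank $n-d-1$, and are such that every $n-d-1$ columns are linearly independent. Let $E_0$ be the set of edges of $G$ that are not edges of $H$. Then: 1. $\mathrm{Gstr}$ is irreducible: it is non-empty, and its Zariski closure in $\mathbb R^{V\times V}$ is not the union of two proper real algebraic subsets. 2. $|E_0| = m-\binom{d+1}{2}$, and $\mathrm{Gstr}$ has real dimension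 $m-\binom{d+1}{2}$: this is the largest $t$ such that some non-empty relatively open subset (in the Euclidean topology) of $\mathrm{Gstr}$ is a smooth $t$-dimensional submanifold of $\mathbb R^{V\times V}$. 3. There are a non-empty Zariski open set $X\subseteq\mathbb R^{E_0}$ and a map $\rho$ on $X$ with values in $\mathbb R^{V\times V}$, each of whose entries is a quotient of two polynomials with denominator nowhere zero on $X$, such that $\rho$ is a bijection from $X$ onto $\mathrm{Gstr}$ and, for every $w\in X$, the matrix $\rho(w)$ has weight $w_e$ at each edge $e\in E_0$. 4. The map $\rho$ is given by the rubber-band construction: for every $w\in X$ and all affinely independent points $\mathbf q_i\in\mathbb R^d$ ($i\in V(H)$), there is exactly one $\mathbf p\in(\mathbb R^d)^V$ with $\mathbf p_i=\mathbf q_i$ for $i\in V(H)$ and $\sum_{j:\,ij\in E(G)} w_{ij}(\mathbf p_i-\mathbf p_j)=0$ for every $i\in V\setminus V(H)$; and $\rho(w)$ is the unique stress matrix of $(G,\mathbf p)$ that has weight $w_e$ at each edge $e\in E_0$. -/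

import Mathlib

open scoped ContDiff

/-! ## Real algebraic geometry in `ℝ^σ` -/

/-- A real algebraic set: the common zeros of finitely many real polynomials. -/
def IsAlgebraicSet {σ : Type*} (A : Set (σ → ℝ)) : Prop :=
  ∃ F : Finset (MvPolynomial σ ℝ), A = {x | ∀ f ∈ F, MvPolynomial.eval x f = 0}

/-- A Zariski open subset of `ℝ^σ`: the complement of an algebraic set. -/
def IsZariskiOpen {σ : Type*} (X : Set (σ → ℝ)) : Prop :=
  IsAlgebraicSet Xᶜ

/-- The Zariski closure of `S`: the smallest algebraic set containing `S`. -/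
def zariskiClosure {σ : Type*} (S : Set (σ → ℝ)) : Set (σ → ℝ) :=
  ⋂₀ {A | IsAlgebraicSet A ∧ S ⊆ A}

/-- A subset of `ℝ^σ` is irreducible if it is non-empty and its Zariski closure is not the union
of two proper algebraic subsets. -/
def IsIrreducibleZariski {σ : Type*} (S : Set (σ → ℝ)) : Prop :=
  S.Nonempty ∧ ∀ A B : Set (σ → ℝ), IsAlgebraicSet A → IsAlgebraicSet B →
    zariskiClosure S = A ∪ B → zariskiClosure S = A ∨ zariskiClosure S = B

/-- The real function `φ` is rational on `X`: there it is a quotient of two polynomials,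
the denominator having no zero in `X`. -/
def IsRationalOn {σ : Type*} (X : Set (σ → ℝ)) (φ : (σ → ℝ) → ℝ) : Prop :=
  ∃ f g : MvPolynomial σ ℝ, ∀ x ∈ X,
    MvPolynomial.eval x g ≠ 0 ∧ φ x = MvPolynomial.eval x f / MvPolynomial.eval x g

/-- `M` is a smooth (embedded) `t`-dimensional submanifold of the finite-dimensional space `E`:
near each of its points, a smooth change of coordinates of `E` straightens `M` to a
`t`-dimensional linear subspace. -/
def IsSmoothSubmanifold {E : Type*} [NormedAddCommGroup E] [NormedSpace ℝ E]
    (t : ℕ) (M : Set E) : Prop :=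
  ∀ x ∈ M, ∃ (e : OpenPartialHomeomorph E E) (L : Submodule ℝ E),
    x ∈ e.source ∧ ContDiffOn ℝ ∞ e e.source ∧ ContDiffOn ℝ ∞ e.symm e.target ∧
    Module.finrank ℝ L = t ∧ e '' (e.source ∩ M) = e.target ∩ (L : Set E)

/-- `S` has real dimension `t`: `t` is the largest number such that some non-empty relatively
open subset of `S` (in the Euclidean topology) is a smooth `t`-dimensional submanifold. -/
def HasRealDimension {E : Type*} [NormedAddCommGroup E] [NormedSpace ℝ E]
    (S : Set E) (t : ℕ) : Prop :=
  IsGreatest {k : ℕ | ∃ U : Set E, IsOpen U ∧ (U ∩ S).Nonempty ∧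
    IsSmoothSubmanifold k (U ∩ S)} t

/-! ## Graphs and stress matrices -/

/-- `G` is `k`-connected: it has more than `k` vertices, and it stays connected when fewer than
`k` vertices are deleted. -/
def IsVertexConnected {V : Type*} [Fintype V] (G : SimpleGraph V) (k : ℕ) : Prop :=
  k < Fintype.card V ∧
    ∀ S : Finset V, S.card < k → (G.induce {v : V | v ∉ S}).Connected

/-- Symmetric matrices with zeros at the non-edges of `G` (off the diagonal) and the all-ones
vector in the kernel. -/
def IsWeightMatrix {V : Type*} [Fintype V] (G : SimpleGraph V) (Ω : Matrix V V ℝ) : Prop :=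
  Ω.IsSymm ∧ (∀ i j : V, i ≠ j → ¬ G.Adj i j → Ω i j = 0) ∧ ∀ i : V, ∑ j, Ω i j = 0

/-- `Ω` is an equilibrium stress matrix of the framework `(G, p)`. -/
def IsStressMatrixOf {V : Type*} [Fintype V] (G : SimpleGraph V) {d : ℕ}
    (p : V → EuclideanSpace ℝ (Fin d)) (Ω : Matrix V V ℝ) : Prop :=
  IsWeightMatrix G Ω ∧ ∀ i : V, ∑ j, Ω i j • (p i - p j) = 0

/-- The set `Gstr` of general position `d`-dimensional stress matrices of `G`: with `n` the number
of vertices, these have rank `n - d - 1`, and every `n - d - 1` columns are linearly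
independent. -/
def Gstr {V : Type*} [Fintype V] (G : SimpleGraph V) (d : ℕ) : Set (Matrix V V ℝ) :=
  {Ω | IsWeightMatrix G Ω ∧ Ω.rank + (d + 1) = Fintype.card V ∧
    ∀ J : Finset V, J.card + (d + 1) = Fintype.card V →
      LinearIndependent ℝ (fun j : J => Ω.col j)}

/-- A matrix as a point of the real space with coordinates indexed by its entries. -/
def matrixCoords {V : Type*} (Ω : Matrix V V ℝ) : V × V → ℝ :=
  fun ij => Ω ij.1 ij.2

/-! ## The rubber band construction relative to a set `H` of vertices -/

/-- The edges of `G` that do not have both ends in `H`. -/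
abbrev OuterEdge {V : Type*} (G : SimpleGraph V) (H : Finset V) : Type _ :=
  {e : Sym2 V // e ∈ G.edgeSet ∧ ¬ ∀ v ∈ e, v ∈ H}

open Classical in
/-- The weight `w_ij` (zero if `ij` is not an edge outside `H`). -/
noncomputable def outerWeight {V : Type*} {G : SimpleGraph V} {H : Finset V}
    (w : OuterEdge G H → ℝ) (i j : V) : ℝ :=
  if h : s(i, j) ∈ G.edgeSet ∧ ¬ ∀ v ∈ s(i, j), v ∈ H then w ⟨s(i, j), h⟩ else 0

/-- The matrix `Ω` carries the weights `w` on the edges outside `H`; the entry of a stress matrix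
at an edge is minus the weight of that edge. -/
def CarriesWeights {V : Type*} {G : SimpleGraph V} {H : Finset V}
    (w : OuterEdge G H → ℝ) (Ω : Matrix V V ℝ) : Prop :=
  ∀ i j : V, ∀ h : s(i, j) ∈ G.edgeSet ∧ ¬ ∀ v ∈ s(i, j), v ∈ H, Ω i j = -w ⟨s(i, j), h⟩

/-- `p` is a rubber band configuration: the vertices of `H` are pinned at `q`, and the vertices
outside `H` are in equilibrium under the weights `w`. -/
def IsRubberBand {V : Type*} [Fintype V] {G : SimpleGraph V} {H : Finset V}
    (w : OuterEdge G H → ℝ) {d : ℕ} (q : H → EuclideanSpace ℝ (Fin d))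
    (p : V → EuclideanSpace ℝ (Fin d)) : Prop :=
  (∀ i : H, p i = q i) ∧ ∀ i : V, i ∉ H → ∑ j, outerWeight w i j • (p i - p j) = 0

/-- `Ω` is produced from the weights `w` by the rubber band construction: however the vertices of
`H` are pinned affinely independently in `ℝ^d`, there is exactly one rubber band configuration
`p`, and `Ω` is the one and only stress matrix of `(G, p)` carrying the weights `w`. -/
def IsRubberBandStress {V : Type*} [Fintype V] {G : SimpleGraph V} {H : Finset V} (d : ℕ)
    (w : OuterEdge G H → ℝ) (Ω : Matrix V V ℝ) : Prop :=
  ∀ q : H → EuclideanSpace ℝ (Fin d), AffineIndependent ℝ q →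
    ∃ p : V → EuclideanSpace ℝ (Fin d),
      (∀ p', IsRubberBand w q p' ↔ p' = p) ∧
      ∀ Ω' : Matrix V V ℝ, (IsStressMatrixOf G p Ω' ∧ CarriesWeights w Ω') ↔ Ω' = Ω

/-!
# General position stress matrices and rubber bands

Let `k = d + 1 = |H|`. The weights `w` on the edges outside `H` determine the rows of a weight
matrix at the vertices outside `H`; these rows form the matrix `outerLaplacian w`, written `D` here,
with square block `A` at the columns outside `H`. If a symmetric matrix has rank `n - k` and
independent columns outside `H`, then `A` is invertible and the matrix equals `Dᵀ A⁻¹ D`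
(`Matrix.IsSymm.eq_mul_inv_mul_of_rank_eq`). Conversely `Dᵀ A⁻¹ D` (`rubberBandMatrix w`) is a
symmetric matrix of rank `n - k` with rows `D` outside `H`. It is a weight matrix because `H` is a
clique, so that its entries inside `H` are unrestricted, and its columns satisfy the same linear
relations as those of `D`. Hence `w ↦ Dᵀ A⁻¹ D` is a bijection onto `Gstr` from the set
`generalWeights` of all `w` for which any `n - k` columns of `D` are independent
(`bijOn_rubberBandMatrix`), and its inverse reads off entries.

The set `generalWeights` is the set of non-zeros of a product of minors of `D`. That none of these
minors vanishes identically is where connectivity enters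
(`IsVertexConnected.exists_linearIndependent_outerLaplacian`). Given `n - k` columns, let `I` be the
set of the `k` other vertices. By Menger's theorem (`exists_isLinkage`) there are `k` disjoint
connected sets joining `I` to `H`, and they extend to a partition of the vertices into connected
sets, each with one vertex in `H` and one in `I`. Take weight `1` on the edges inside the parts and
`0` elsewhere. A function harmonic outside `H` is then constant on every part, so it vanishes if it
vanishes on `I`: the chosen columns are independent.

The remaining claims follow from this parametrization.
* The image of a basic open set under a rational map is irreducible (`isIrreducibleZariski_image`).
* The image of a smooth section of a surjective linear map is a submanifold of the dimension of the
  target of that map, and no submanifold inside it has a larger dimension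
  (`hasRealDimension_image_of_section`).
* The rubber band configuration is the solution of a linear system with matrix `A`. A stress matrix
  carrying `w` has the rows `D` outside `H`, and its block at `H` is forced because an affinely
  independent family has no affine dependency (`isRubberBandStress_rubberBandMatrix`).
-/

/-! ### Menger's theorem for connected sets -/

/-- `(P, Q)` is a separation of `G` with `A` on the side of `P` and `B` on the side of `Q`:
the two sides cover the vertices, and no edge joins `P \ Q` to `Q \ P`. -/
structure IsSeparation {V : Type*} (G : SimpleGraph V) (A B P Q : Set V) : Prop where
  cover : ∀ v, v ∈ P ∨ v ∈ Q
  left : A ⊆ P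
  right : B ⊆ Q
  not_adj : ∀ u v, u ∉ Q → v ∉ P → ¬ G.Adj u v

/-- The sets `C i`, for `i ∈ I`, are disjoint, connected in `G`, and each of them meets both `A`
and `B`. Such a family amounts to disjoint paths from `A` to `B`. -/
structure IsLinkage {V : Type*} (G : SimpleGraph V) (A B I : Set V) (C : V → Set V) : Prop where
  connected : ∀ i ∈ I, (G.induce (C i)).Connected
  left : ∀ i ∈ I, (C i ∩ A).Nonempty
  right : ∀ i ∈ I, (C i ∩ B).Nonempty
  disjoint : I.PairwiseDisjoint C

/-- The spanning subgraph of `G` whose edges are those with both ends in `P`. -/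
def edgesWithin {V : Type*} (G : SimpleGraph V) (P : Set V) : SimpleGraph V where
  Adj u v := G.Adj u v ∧ u ∈ P ∧ v ∈ P
  symm := ⟨fun _ _ h => ⟨h.1.symm, h.2.2, h.2.1⟩⟩
  loopless := ⟨fun _ h => h.1.ne rfl⟩

section Menger

variable {V : Type*} {G G' : SimpleGraph V} {A B P Q I X : Set V} {C : V → Set V}

lemma IsSeparation.symm (h : IsSeparation G A B P Q) : IsSeparation G B A Q P :=
  ⟨fun v => (h.cover v).symm, h.right, h.left, fun u v hu hv huv => h.not_adj v u hv hu huv.symm⟩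

lemma IsLinkage.symm (h : IsLinkage G A B I C) : IsLinkage G B A I C :=
  ⟨h.connected, h.right, h.left, h.disjoint⟩

lemma IsLinkage.mono (hG : G ≤ G') (h : IsLinkage G A B I C) : IsLinkage G' A B I C :=
  ⟨fun i hi => (h.connected i hi).mono fun _ _ hab => hG hab, h.left, h.right, h.disjoint⟩

lemma edgesWithin_le : edgesWithin G P ≤ G := fun _ _ h => h.1

lemma edgesWithin_lt {x y : V} (hxy : G.Adj x y) (h : x ∉ P ∨ y ∉ P) : edgesWithin G P < G := by
  refine lt_of_le_of_ne edgesWithin_le fun he => ?_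
  have : (edgesWithin G P).Adj x y := by rw [he]; exact hxy
  rcases h with h | h
  · exact h this.2.1
  · exact h this.2.2

/-- A connected set of `edgesWithin G P` that meets `P` lies in `P`, as the other vertices are
isolated. -/
lemma subset_of_connected_edgesWithin {D : Set V}
    (hD : ((edgesWithin G P).induce D).Connected) (hDP : (D ∩ P).Nonempty) : D ⊆ P := by
  obtain ⟨a, haD, haP⟩ := hDP
  intro v hv
  by_contra hvP
  obtain ⟨w⟩ := hD.preconnected ⟨a, haD⟩ ⟨v, hv⟩
  obtain ⟨e, -, he, he'⟩ := w.exists_boundary_dart {u | (u : V) ∈ P} haP hvP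
  exact he' e.adj.2.2

/-- A linkage with as many members as the target `X` has vertices can be labelled by the vertices
of `X`, each member containing its label and no other vertex of `X`. -/
lemma IsLinkage.exists_relabel [Finite V] (h : IsLinkage G A X I C) (hcard : I.ncard = X.ncard) :
    ∃ D : V → Set V, IsLinkage G A X X D ∧ (∀ x ∈ X, x ∈ D x) ∧
      ∀ x ∈ X, ∀ v ∈ X, v ∈ D x → v = x := by
  classical
  choose! f hf using h.right
  have hinj : Set.InjOn f I := by
    intro i hi j hj hij
    by_contra hne
    exact Set.disjoint_left.1 (h.disjoint hi hj hne) (hf i hi).1 (hij ▸ (hf j hj).1)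
  have himg : f '' I = X :=
    Set.eq_of_subset_of_ncard_le (by rintro _ ⟨i, hi, rfl⟩; exact (hf i hi).2)
      (by rw [hinj.ncard_image, hcard]) (Set.toFinite _)
  have hex : ∀ x ∈ X, ∃ i ∈ I, f i = x := fun x hx => by rwa [← himg] at hx
  choose! g hg hfg using hex
  have hdisj : X.PairwiseDisjoint (fun x => C (g x)) := fun x hx y hy hxy =>
    h.disjoint (hg x hx) (hg y hy) fun hg' => hxy (by rw [← hfg x hx, ← hfg y hy, hg'])
  have hmem : ∀ x ∈ X, x ∈ C (g x) := fun x hx => by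
    have := (hf _ (hg x hx)).1
    rwa [hfg x hx] at this
  refine ⟨fun x => C (g x), ⟨fun x hx => h.connected _ (hg x hx), fun x hx => h.left _ (hg x hx),
    fun x hx => h.right _ (hg x hx), hdisj⟩, hmem, fun x hx v hv hvx => ?_⟩
  by_contra hne
  exact Set.disjoint_left.1 (hdisj hv hx hne) (hmem v hv) hvx

/-- Let `(P, Q)` separate `A` from `B` once the edge `xy` is deleted, with `y ∉ P`. Every separation
of `A` from `P ∩ Q` together with `x` in the part of `G` inside `P` is at least as large as some
separation of `A` from `B` in `G`. -/
lemma exists_isSeparation_of_edgesWithin [Finite V] {x y : V} {P' Q' : Set V}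
    (hPQ : IsSeparation (G.deleteEdges {s(x, y)}) A B P Q) (hy : y ∉ P)
    (h : IsSeparation (edgesWithin G P) A (insert x (P ∩ Q)) P' Q') :
    ∃ P'' Q'', IsSeparation G A B P'' Q'' ∧ (P'' ∩ Q'').ncard ≤ (P' ∩ Q').ncard := by
  refine ⟨P ∩ P', (Q' ∩ P) ∪ Q, ⟨fun v => ?_, fun v hv => ⟨hPQ.left hv, h.left hv⟩,
    fun v hv => Or.inr (hPQ.right hv), fun u v hu hv huv => ?_⟩,
    Set.ncard_le_ncard ?_ (Set.toFinite _)⟩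
  · have h1 := h.cover v
    have h2 := hPQ.cover v
    simp only [Set.mem_inter_iff, Set.mem_union]
    tauto
  · have hu1 : u ∉ Q := fun h' => hu (Or.inr h')
    have hu2 : u ∈ P := (hPQ.cover u).resolve_right hu1
    have hu3 : u ∉ Q' := fun h' => hu (Or.inl ⟨h', hu2⟩)
    by_cases hvP : v ∈ P
    · exact h.not_adj u v hu3 (fun h' => hv ⟨hvP, h'⟩) ⟨huv, hu2, hvP⟩
    · have := hPQ.not_adj u v hu1 hvP
      rw [SimpleGraph.deleteEdges_adj] at this
      have he : s(u, v) = s(x, y) := by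
        by_contra hne
        exact this ⟨huv, hne⟩
      rcases Sym2.eq_iff.1 he with ⟨rfl, rfl⟩ | ⟨rfl, rfl⟩
      · exact hu3 (h.right (Set.mem_insert _ _))
      · exact hy hu2
  · rintro v ⟨⟨hvP, hvP'⟩, hv | hv⟩
    · exact ⟨hvP', hv.1⟩
    · exact ⟨hvP', h.right (Set.mem_insert_of_mem _ ⟨hvP, hv⟩)⟩

/-- Two linkages on the two sides of `(P, Q)` are glued along `P ∩ Q` and the edge `xy`. -/
lemma exists_isLinkage_of_glue [Finite V] {x y : V} {I₁ I₂ : Set V} {C₁ C₂ : V → Set V}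
    (hxy : G.Adj x y) (hAP : A ⊆ P) (hBQ : B ⊆ Q)
    (hx : x ∉ Q) (hy : y ∉ P)
    (h₁ : IsLinkage (edgesWithin G P) A (insert x (P ∩ Q)) I₁ C₁)
    (h₂ : IsLinkage (edgesWithin G Q) (insert y (P ∩ Q)) B I₂ C₂)
    (hI₁ : I₁.ncard = (P ∩ Q).ncard + 1) (hI₂ : I₂.ncard = (P ∩ Q).ncard + 1) :
    ∃ C, IsLinkage G A B (insert x (P ∩ Q)) C := by
  classical
  have hxS : x ∉ P ∩ Q := fun h => hx h.2
  have hyS : y ∉ P ∩ Q := fun h => hy h.1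
  obtain ⟨D, hD, hDmem, hDuniq⟩ := h₁.exists_relabel
    (hI₁.trans (Set.ncard_insert_of_notMem hxS (Set.toFinite _)).symm)
  obtain ⟨F, hF, hFmem, hFuniq⟩ := h₂.symm.exists_relabel
    (hI₂.trans (Set.ncard_insert_of_notMem hyS (Set.toFinite _)).symm)
  have hDP : ∀ i ∈ insert x (P ∩ Q), D i ⊆ P := fun i hi =>
    subset_of_connected_edgesWithin (hD.connected i hi)
      ((hD.left i hi).mono (Set.inter_subset_inter_right _ hAP))
  have hFQ : ∀ i ∈ insert y (P ∩ Q), F i ⊆ Q := fun i hi =>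
    subset_of_connected_edgesWithin (hF.connected i hi)
      ((hF.left i hi).mono (Set.inter_subset_inter_right _ hBQ))
  have hDc := (hD.mono edgesWithin_le).connected
  have hFc := (hF.mono edgesWithin_le).connected
  -- the member through `x` continues along the edge `xy`, the others through their label
  set τ : V → V := fun i => if i = x then y else i with hτ
  have hτx : τ x = y := by simp [hτ]
  have hτS : ∀ i ∈ P ∩ Q, τ i = i := fun i hi => by
    have : i ≠ x := fun h => hxS (h ▸ hi)
    simp [hτ, this]
  have hτmem : ∀ i ∈ insert x (P ∩ Q), τ i ∈ insert y (P ∩ Q) := by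
    rintro i (rfl | hi)
    · rw [hτx]; exact Set.mem_insert _ _
    · rw [hτS i hi]; exact Set.mem_insert_of_mem _ hi
  have hτinj : Set.InjOn τ (insert x (P ∩ Q)) := by
    rintro i (rfl | hi) j (rfl | hj) hij
    · rfl
    · rw [hτx, hτS j hj] at hij; exact absurd (hij ▸ hj) hyS
    · rw [hτx, hτS i hi] at hij; exact absurd (hij ▸ hi) hyS
    · rwa [hτS i hi, hτS j hj] at hij
  have hcross : ∀ i ∈ insert x (P ∩ Q), ∀ j ∈ insert x (P ∩ Q), i ≠ j →
      Disjoint (D i) (F (τ j)) := by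
    intro i hi j hj hne
    refine Set.disjoint_left.2 fun v hvD hvF => hne ?_
    have hvS : v ∈ P ∩ Q := ⟨hDP i hi hvD, hFQ _ (hτmem j hj) hvF⟩
    have h1 : v = i := hDuniq i hi v (Set.mem_insert_of_mem _ hvS) hvD
    have h2 : v = τ j := hFuniq _ (hτmem j hj) v (Set.mem_insert_of_mem _ hvS) hvF
    apply hτinj hi hj
    rw [← h2, ← h1, hτS v hvS]
  refine ⟨fun i => D i ∪ F (τ i), ⟨fun i hi => ?_,
    fun i hi => (hD.left i hi).mono (Set.inter_subset_inter_left _ Set.subset_union_left),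
    fun i hi => (hF.left _ (hτmem i hi)).mono
      (Set.inter_subset_inter_left _ Set.subset_union_right), ?_⟩⟩
  · have hi' := hτmem i hi
    rcases hi with rfl | hiS
    · refine SimpleGraph.connected_induce_union (hDc _ (Set.mem_insert _ _)).preconnected
        (hFc _ hi').preconnected (hDmem _ (Set.mem_insert _ _)) (hFmem _ hi') ?_
      rwa [hτx]
    · exact SimpleGraph.induce_union_connected
        (hDc i (Set.mem_insert_of_mem _ hiS)).preconnected (hFc _ hi').preconnected
        ⟨i, hDmem i (Set.mem_insert_of_mem _ hiS), by
          have := hFmem _ hi'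
          rwa [hτS i hiS] at this ⊢⟩
  · intro i hi j hj hne
    refine Set.disjoint_union_left.2 ⟨Set.disjoint_union_right.2 ⟨hD.disjoint hi hj hne,
      hcross i hi j hj hne⟩, Set.disjoint_union_right.2 ⟨(hcross j hj i hi hne.symm).symm,
      hF.disjoint (hτmem i hi) (hτmem j hj) fun h => hne (hτinj hi hj h)⟩⟩

/-- **Menger's theorem** for sets of vertices: if no separation of `A` from `B` has fewer than `k`
vertices in common to its two sides, then there are `k` disjoint connected sets meeting both `A`
and `B`. The proof deletes an edge `xy`; if this creates a separation `(P, Q)` with fewer than `k`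
common vertices, then the two sides are linked separately and the linkages are glued. -/
theorem exists_isLinkage [Finite V] (G : SimpleGraph V) (A B : Set V) (k : ℕ)
    (h : ∀ P Q, IsSeparation G A B P Q → k ≤ (P ∩ Q).ncard) :
    ∃ I C, I.ncard = k ∧ IsLinkage G A B I C := by
  classical
  induction G using WellFoundedLT.induction generalizing A B with
  | ind G ih =>
  by_cases hE : ∃ x y, G.Adj x y
  · obtain ⟨x, y, hxy⟩ := hE
    by_cases hdel : ∀ P Q, IsSeparation (G.deleteEdges {s(x, y)}) A B P Q → k ≤ (P ∩ Q).ncard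
    · have hlt : G.deleteEdges {s(x, y)} < G := by
        refine lt_of_le_of_ne (SimpleGraph.deleteEdges_le _) fun he => ?_
        have : (G.deleteEdges {s(x, y)}).Adj x y := by rw [he]; exact hxy
        rw [SimpleGraph.deleteEdges_adj] at this
        exact this.2 rfl
      obtain ⟨I, C, hI, hC⟩ := ih _ hlt A B hdel
      exact ⟨I, C, hI, hC.mono (SimpleGraph.deleteEdges_le _)⟩
    · push Not at hdel
      obtain ⟨P, Q, hPQ, hlt⟩ := hdel
      -- the deleted edge has to cross the separation; its ends are named accordingly
      obtain ⟨x', y', he, hx, hy⟩ : ∃ x' y', s(x', y') = s(x, y) ∧ x' ∉ Q ∧ y' ∉ P := by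
        by_contra hno
        push Not at hno
        refine absurd (h P Q ⟨hPQ.cover, hPQ.left, hPQ.right, fun u v hu hv huv => ?_⟩) (by omega)
        refine hPQ.not_adj u v hu hv ?_
        rw [SimpleGraph.deleteEdges_adj]
        exact ⟨huv, fun he => hv (hno u v he hu)⟩
      rw [← he] at hPQ
      have hxy' : G.Adj x' y' := by
        rw [← SimpleGraph.mem_edgeSet, he]; exact hxy
      have hPQ' : IsSeparation (G.deleteEdges {s(y', x')}) B A Q P := by
        rw [Sym2.eq_swap]; exact hPQ.symm
      have hxP : x' ∈ P := (hPQ.cover x').resolve_right hx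
      have hk : k = (P ∩ Q).ncard + 1 := by
        refine le_antisymm ?_ hlt
        have hsep : IsSeparation G A B P (insert x' Q) := by
          refine ⟨fun v => (hPQ.cover v).imp_right (Set.mem_insert_of_mem _), hPQ.left,
            hPQ.right.trans (Set.subset_insert _ _), fun u v hu hv huv => ?_⟩
          refine hPQ.not_adj u v (fun h' => hu (Set.mem_insert_of_mem _ h')) hv ?_
          rw [SimpleGraph.deleteEdges_adj]
          refine ⟨huv, fun he' => ?_⟩
          rcases Sym2.eq_iff.1 he' with ⟨rfl, rfl⟩ | ⟨rfl, rfl⟩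
          · exact hu (Set.mem_insert _ _)
          · exact hv hxP
        refine (h _ _ hsep).trans ?_
        rw [Set.inter_insert_of_mem hxP]
        exact Set.ncard_insert_le _ _
      obtain ⟨I₁, C₁, hI₁, hC₁⟩ := ih (edgesWithin G P) (edgesWithin_lt hxy' (Or.inr hy)) A
        (insert x' (P ∩ Q)) fun P' Q' h' => by
          obtain ⟨P'', Q'', hs, hle⟩ := exists_isSeparation_of_edgesWithin hPQ hy h'
          exact (h _ _ hs).trans hle
      obtain ⟨I₂, C₂, hI₂, hC₂⟩ := ih (edgesWithin G Q) (edgesWithin_lt hxy' (Or.inl hx)) B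
        (insert y' (Q ∩ P)) fun P' Q' h' => by
          obtain ⟨P'', Q'', hs, hle⟩ := exists_isSeparation_of_edgesWithin hPQ' hx h'
          refine (h _ _ hs.symm).trans ?_
          rwa [Set.inter_comm]
      rw [Set.inter_comm Q P] at hC₂
      obtain ⟨C, hC⟩ := exists_isLinkage_of_glue hxy' hPQ.left hPQ.right hx hy hC₁ hC₂.symm
        (hI₁.trans hk) (hI₂.trans hk)
      exact ⟨_, C, by rw [Set.ncard_insert_of_notMem (fun h => hx h.2) (Set.toFinite _), hk], hC⟩
  · push Not at hE
    have hk := h A (Aᶜ ∪ B) ⟨fun v => by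
      by_cases hv : v ∈ A
      · exact Or.inl hv
      · exact Or.inr (Or.inl hv), subset_rfl, Set.subset_union_right, fun u v _ _ => hE u v⟩
    obtain ⟨I, hI, hIk⟩ := Set.exists_subset_card_eq hk
    refine ⟨I, fun i => {i}, hIk, ⟨fun i _ => ?_, fun i hi => ⟨i, rfl, (hI hi).1⟩,
      fun i hi => ⟨i, rfl, ?_⟩, fun i _ j _ hij => by simpa using hij⟩⟩
    · exact ⟨SimpleGraph.Preconnected.of_subsingleton⟩
    · exact (hI hi).2.resolve_left fun h' => h' (hI hi).1

end Menger

/-! ### Partitions into connected fibres and harmonic functions -/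

/-- The spanning subgraph of `G` whose edges join vertices with the same value of `c`. -/
def fiberGraph {V : Type*} (G : SimpleGraph V) (c : V → V) : SimpleGraph V where
  Adj u v := G.Adj u v ∧ c u = c v
  symm := ⟨fun _ _ h => ⟨h.1.symm, h.2.symm⟩⟩
  loopless := ⟨fun _ h => h.1.ne rfl⟩

section Partition

variable {V : Type*} {G : SimpleGraph V}

lemma IsVertexConnected.exists_adj_boundary [Fintype V] {k : ℕ} (hG : IsVertexConnected G k)
    (hk : 0 < k) {W : Set V} {a b : V} (ha : a ∈ W) (hb : b ∉ W) :
    ∃ u v, u ∈ W ∧ v ∉ W ∧ G.Adj u v := by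
  obtain ⟨w⟩ := (hG.2 ∅ (by simpa using hk)).preconnected ⟨a, by simp⟩ ⟨b, by simp⟩
  obtain ⟨e, -, he, he'⟩ := w.exists_boundary_dart {u | (u : V) ∈ W} ha hb
  exact ⟨_, _, he, he', e.adj⟩

lemma IsVertexConnected.le_ncard_inter [Fintype V] {k : ℕ} (hG : IsVertexConnected G k)
    {A B : Finset V} (hA : k ≤ A.card) (hB : k ≤ B.card) {P Q : Set V}
    (h : IsSeparation G (A : Set V) B P Q) : k ≤ (P ∩ Q).ncard := by
  classical
  by_contra hlt
  push Not at hlt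
  set S : Finset V := (P ∩ Q).toFinite.toFinset with hS
  have hmem : ∀ v, v ∈ S ↔ v ∈ P ∧ v ∈ Q := fun v => by simp [hS]
  have hScard : S.card < k := by rwa [hS, ← Set.ncard_eq_toFinset_card]
  obtain ⟨a, haA, haS⟩ := Finset.exists_mem_notMem_of_card_lt_card (hScard.trans_le hA)
  obtain ⟨b, hbB, hbS⟩ := Finset.exists_mem_notMem_of_card_lt_card (hScard.trans_le hB)
  have haP : a ∈ P := h.left haA
  have hbP : b ∉ P := fun hb => hbS ((hmem b).2 ⟨hb, h.right hbB⟩)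
  obtain ⟨w⟩ := (hG.2 S hScard).preconnected ⟨a, haS⟩ ⟨b, hbS⟩
  obtain ⟨e, -, he, he'⟩ := w.exists_boundary_dart {u | (u : V) ∈ P} haP hbP
  exact h.not_adj _ _ (fun hQ => e.fst.2 ((hmem _).2 ⟨he, hQ⟩)) he' e.adj

/-- Disjoint connected sets in a connected graph can be enlarged to a partition of the vertices
into connected sets. -/
lemma IsLinkage.exists_partition [Fintype V] {k : ℕ} (hG : IsVertexConnected G k) (hk : 0 < k)
    {A H : Set V} {C : V → Set V} (hC : IsLinkage G A H H C) (hmem : ∀ h ∈ H, h ∈ C h)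
    (hH : H.Nonempty) :
    ∃ c : V → V, (∀ v, c v ∈ H) ∧ (∀ h ∈ H, ∀ v ∈ C h, c v = h) ∧
      ∀ v, (fiberGraph G c).Reachable (c v) v := by
  classical
  -- `𝒲` consists of the vertex sets to which a partition has been extended
  let 𝒲 : Set (Set V) := {W | (∀ h ∈ H, C h ⊆ W) ∧ ∃ c : V → V, (∀ h ∈ H, ∀ v ∈ C h, c v = h) ∧
    ∀ v ∈ W, c v ∈ H ∧ (fiberGraph (edgesWithin G W) c).Reachable (c v) v}
  have hne : 𝒲.Nonempty := by
    refine ⟨⋃ h ∈ H, C h, fun h hh => Set.subset_biUnion_of_mem (u := C) hh, ?_⟩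
    have hex : ∀ v, ∃ h, v ∈ (⋃ h ∈ H, C h) → h ∈ H ∧ v ∈ C h := fun v => by
      by_cases hv : v ∈ ⋃ h ∈ H, C h
      · obtain ⟨h, hh, hvh⟩ := Set.mem_iUnion₂.1 hv
        exact ⟨h, fun _ => ⟨hh, hvh⟩⟩
      · exact ⟨v, fun h => absurd h hv⟩
    choose c hc using hex
    have hcC : ∀ h ∈ H, ∀ v ∈ C h, c v = h := fun h hh v hv => by
      by_contra hne
      obtain ⟨h1, h2⟩ := hc v (Set.mem_biUnion hh hv)
      exact Set.disjoint_left.1 (hC.disjoint h1 hh hne) h2 hv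
    refine ⟨c, hcC, fun v hv => ⟨(hc v hv).1, ?_⟩⟩
    obtain ⟨h1, h2⟩ := hc v hv
    obtain ⟨p⟩ := (hC.connected _ h1).preconnected ⟨c v, hmem _ h1⟩ ⟨v, h2⟩
    let f : G.induce (C (c v)) →g fiberGraph (edgesWithin G (⋃ h ∈ H, C h)) c :=
      ⟨Subtype.val, fun {a b} hab => ⟨⟨hab, Set.mem_biUnion h1 a.2, Set.mem_biUnion h1 b.2⟩, by
        rw [hcC _ h1 _ a.2, hcC _ h1 _ b.2]⟩⟩
    exact ⟨p.map f⟩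
  obtain ⟨W, ⟨hCW, c, hcC, hcW⟩, hmax⟩ := 𝒲.toFinite.exists_maximal hne
  have hW : ∀ v, v ∈ W := by
    by_contra hno
    push Not at hno
    obtain ⟨b, hb⟩ := hno
    obtain ⟨h, hh⟩ := hH
    obtain ⟨u, v, hu, hv, huv⟩ := hG.exists_adj_boundary hk (hCW h hh (hmem h hh)) hb
    have hcu : ∀ z ∈ W, Function.update c v (c u) z = c z := fun z hz =>
      Function.update_of_ne (by rintro rfl; exact hv hz) _ _
    have hle : fiberGraph (edgesWithin G W) c ≤
        fiberGraph (edgesWithin G (insert v W)) (Function.update c v (c u)) := by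
      rintro p q ⟨⟨h1, h2, h3⟩, h4⟩
      exact ⟨⟨h1, Set.mem_insert_of_mem _ h2, Set.mem_insert_of_mem _ h3⟩, by
        rw [hcu _ h2, hcu _ h3, h4]⟩
    have hmem' : insert v W ∈ 𝒲 := by
      refine ⟨fun h hh => (hCW h hh).trans (Set.subset_insert _ _), Function.update c v (c u),
        fun h hh z hz => by rw [hcu _ (hCW h hh hz), hcC h hh z hz], ?_⟩
      rintro z (rfl | hz)
      · rw [Function.update_self]
        refine ⟨(hcW u hu).1, ((hcW u hu).2.mono hle).trans (SimpleGraph.Adj.reachable ?_)⟩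
        exact ⟨⟨huv, Set.mem_insert_of_mem _ hu, Set.mem_insert _ _⟩, by
          rw [hcu _ hu, Function.update_self]⟩
      · rw [hcu z hz]
        exact ⟨(hcW z hz).1, (hcW z hz).2.mono hle⟩
    exact hv (hmax hmem' (Set.subset_insert _ _) (Set.mem_insert _ _))
  have hle : fiberGraph (edgesWithin G W) c ≤ fiberGraph G c := fun _ _ h => ⟨h.1.1, h.2⟩
  exact ⟨c, fun v => (hcW v (hW v)).1, hcC, fun v => (hcW v (hW v)).2.mono hle⟩

/-- In a `k`-connected graph with sets `H` and `I` of `k` vertices, the vertices can be partitioned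
into connected sets each of which contains one vertex of `H` and one of `I`. -/
lemma IsVertexConnected.exists_partition [Fintype V] {k : ℕ} (hG : IsVertexConnected G k)
    (hk : 0 < k) {H I : Finset V} (hH : H.card = k) (hI : I.card = k) :
    ∃ c : V → V, (∀ v, c v ∈ H) ∧ (∀ h ∈ H, c h = h) ∧
      (∀ v, (fiberGraph G c).Reachable (c v) v) ∧ ∀ h ∈ H, ∃ a ∈ I, c a = h := by
  obtain ⟨J, C', hJ, hC'⟩ := exists_isLinkage G (I : Set V) H k
    fun P Q h => hG.le_ncard_inter hI.ge hH.ge h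
  obtain ⟨C, hC, hmem, -⟩ := hC'.exists_relabel (by rw [hJ, Set.ncard_coe_finset, hH])
  obtain ⟨c, h1, h2, h3⟩ := hC.exists_partition hG hk hmem
    (Finset.coe_nonempty.2 (Finset.card_pos.1 (by omega)))
  refine ⟨c, h1, fun h hh => h2 h hh h (hmem h hh), h3, fun h hh => ?_⟩
  obtain ⟨a, ha, haI⟩ := hC.left h hh
  exact ⟨a, haI, h2 h hh a ha⟩

open Classical in
/-- A function that is harmonic at the vertices outside `H`, for the graph in which every component
meets `H` in one vertex, is constant on the components. -/
lemma eq_comp_of_harmonic_fiberGraph [Fintype V] {H : Finset V} {c : V → V}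
    (hcH : ∀ v, c v ∈ H) (hc : ∀ h ∈ H, c h = h)
    (hreach : ∀ v, (fiberGraph G c).Reachable (c v) v) {x : V → ℝ}
    (hx : ∀ u, u ∉ H → ∑ j, (if (fiberGraph G c).Adj u j then x u - x j else 0) = 0) (v : V) :
    x v = x (c v) := by
  set F := fiberGraph G c with hF
  -- subtracting the value at the vertex of `H` keeps `x` harmonic, and makes it vanish on `H`
  set z : V → ℝ := fun v => x v - x (c v) with hz
  have hlap : ∀ u, (F.lapMatrix ℝ).mulVec z u =
      ∑ j, (if F.Adj u j then x u - x j else 0) := by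
    intro u
    rw [SimpleGraph.lapMatrix_mulVec_apply, SimpleGraph.degree, ← nsmul_eq_mul,
      ← Finset.sum_const, ← Finset.sum_sub_distrib, ← Finset.sum_filter,
      SimpleGraph.neighborFinset_eq_filter]
    refine Finset.sum_congr rfl fun j hj => ?_
    have hj' : F.Adj u j := by simpa using hj
    simp only [hz, hj'.2]
    ring
  have hzero : z ⬝ᵥ (F.lapMatrix ℝ).mulVec z = 0 := by
    refine Finset.sum_eq_zero fun u _ => ?_
    by_cases hu : u ∈ H
    · simp [hz, hc u hu]
    · rw [hlap u, hx u hu, mul_zero]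
  rw [← Matrix.toLinearMap₂'_apply',
    SimpleGraph.lapMatrix_toLinearMap₂'_apply'_eq_zero_iff_forall_reachable] at hzero
  have := hzero _ _ (hreach v)
  simp only [hz, hc _ (hcH v)] at this
  linarith

end Partition

/-! ### Symmetric matrices determined by a nonsingular principal block -/

section PrincipalBlock

open scoped Matrix

/-- The square block of `D` at the columns that also index its rows. -/
abbrev principalBlock {K V : Type*} {p : V → Prop} (D : Matrix {v // p v} V K) :
    Matrix {v // p v} {v // p v} K :=
  D.submatrix id Subtype.val

variable {K V : Type*} [Field K] {p : V → Prop} [Fintype {v // p v}]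
  [DecidableEq {v // p v}]

/-- A symmetric matrix whose rank is that of a set of independent columns is determined by these
columns: with `D` the corresponding rows and `A` the corresponding principal block, `A` is
invertible and the matrix is `Dᵀ * A⁻¹ * D`. -/
lemma Matrix.IsSymm.eq_mul_inv_mul_of_rank_eq [Fintype V] {Ω : Matrix V V K}
    (hΩ : Ω.IsSymm) (hrank : Ω.rank = Fintype.card {v // p v})
    (hli : LinearIndependent K (fun u : {v // p v} => Ω.col u)) :
    IsUnit (Ω.submatrix Subtype.val Subtype.val : Matrix {v // p v} {v // p v} K) ∧
      Ω = (Ω.submatrix Subtype.val id : Matrix {v // p v} V K)ᵀ *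
        (Ω.submatrix Subtype.val Subtype.val : Matrix {v // p v} {v // p v} K)⁻¹ *
        (Ω.submatrix Subtype.val id : Matrix {v // p v} V K) := by
  set D : Matrix {v // p v} V K := Ω.submatrix Subtype.val id with hD
  set A : Matrix {v // p v} {v // p v} K := Ω.submatrix Subtype.val Subtype.val with hA
  have hDT : Dᵀ.col = fun u : {v // p v} => Ω.col u := by
    ext u v
    exact hΩ.apply _ _
  have hspan : Submodule.span K (Set.range fun u : {v // p v} => Ω.col u) =
      Submodule.span K (Set.range Ω.col) := by
    refine Submodule.eq_of_le_of_finrank_eq (Submodule.span_mono ?_) ?_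
    · rintro _ ⟨u, rfl⟩
      exact ⟨_, rfl⟩
    · rw [finrank_span_eq_card hli, ← Matrix.rank_eq_finrank_span_cols, hrank]
  have hcol : ∀ j, ∃ z : {v // p v} → K, ∑ u, z u • Ω.col u = Ω.col j := fun j => by
    rw [← Submodule.mem_span_range_iff_exists_fun, hspan]
    exact Submodule.subset_span ⟨j, rfl⟩
  choose z hz using hcol
  let Z : Matrix {v // p v} V K := Matrix.of fun u j => z j u
  have hΩZ : Ω = Dᵀ * Z := by
    ext i j
    have := congrFun (hz j) i
    simp only [Finset.sum_apply, Pi.smul_apply, smul_eq_mul, Matrix.col_apply] at this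
    rw [← this, Matrix.mul_apply]
    refine Finset.sum_congr rfl fun u _ => ?_
    rw [mul_comm]
    exact congrArg (· * z j u) (hΩ.apply _ _).symm
  have hDZ : D = A * Z := by
    ext u j
    have := congrFun (congrFun hΩZ u) j
    rw [Matrix.mul_apply] at this ⊢
    refine this.trans (Finset.sum_congr rfl fun v _ => ?_)
    exact congrArg (· * Z v j) (hΩ.apply _ _)
  have hAT : Aᵀ = A := hΩ.submatrix _
  have hunit : IsUnit A := by
    rw [← Matrix.mulVec_injective_iff_isUnit]
    have hinj : Function.Injective Dᵀ.mulVec := by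
      rw [Matrix.mulVec_injective_iff, hDT]; exact hli
    have hfac : Dᵀ = Zᵀ * A := by rw [hDZ, Matrix.transpose_mul, hAT]
    intro x y hxy
    apply hinj
    rw [hfac, ← Matrix.mulVec_mulVec, ← Matrix.mulVec_mulVec]
    exact congrArg _ hxy
  refine ⟨hunit, ?_⟩
  have hZ : Z = A⁻¹ * D := by
    rw [hDZ, Matrix.nonsing_inv_mul_cancel_left _ _ ((Matrix.isUnit_iff_isUnit_det A).1 hunit)]
  rw [Matrix.mul_assoc, ← hZ]
  exact hΩZ

variable {D : Matrix {v // p v} V K}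

/-- The extension `Dᵀ * A⁻¹ * D` of the rows `D`, where `A` is their principal block. If `A` is
symmetric and invertible, this is the symmetric matrix of least rank that has the rows `D`. -/
noncomputable def schurExtension (D : Matrix {v // p v} V K) : Matrix V V K :=
  Dᵀ * (principalBlock D)⁻¹ * D

lemma schurExtension_apply_row (hA : IsUnit (principalBlock D))
    (hsymm : (principalBlock D).IsSymm) (u : {v // p v}) (j : V) :
    schurExtension D u j = D u j := by
  have h : (schurExtension D).submatrix (Subtype.val : {v // p v} → V) id =
      (principalBlock D)ᵀ * (principalBlock D)⁻¹ * D := by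
    rw [schurExtension, Matrix.submatrix_mul _ _ _ id _ Function.bijective_id,
      Matrix.submatrix_mul _ _ _ id _ Function.bijective_id]
    rfl
  rw [hsymm.eq, Matrix.mul_nonsing_inv _ ((Matrix.isUnit_iff_isUnit_det _).1 hA),
    Matrix.one_mul] at h
  exact congrFun (congrFun h u) j

lemma isSymm_schurExtension (hsymm : (principalBlock D).IsSymm) :
    (schurExtension D).IsSymm := by
  rw [Matrix.IsSymm, schurExtension, Matrix.transpose_mul, Matrix.transpose_mul,
    Matrix.transpose_transpose, Matrix.transpose_nonsing_inv, hsymm.eq, Matrix.mul_assoc]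

lemma injective_mulVec_transpose_mul_inv (hA : IsUnit (principalBlock D)) :
    Function.Injective (Dᵀ * (principalBlock D)⁻¹).mulVec := by
  have h1 : Function.Injective Dᵀ.mulVec := by
    intro x y hxy
    have hAT : IsUnit (principalBlock D)ᵀ := (Matrix.isUnit_transpose _).2 hA
    apply Matrix.mulVec_injective_iff_isUnit.2 hAT
    ext u
    exact congrFun hxy u
  intro x y hxy
  simp only [← Matrix.mulVec_mulVec] at hxy
  exact Matrix.mulVec_injective_iff_isUnit.2 (Matrix.isUnit_nonsing_inv_iff.2 hA) (h1 hxy)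

lemma linearIndependent_col_schurExtension_iff (hA : IsUnit (principalBlock D))
    {ι : Type*} (f : ι → V) :
    LinearIndependent K (fun j => (schurExtension D).col (f j)) ↔
      LinearIndependent K (fun j => D.col (f j)) := by
  set M := Dᵀ * (principalBlock D)⁻¹ with hM
  have hker : LinearMap.ker M.mulVecLin = ⊥ :=
    LinearMap.ker_eq_bot.2 (injective_mulVec_transpose_mul_inv hA)
  rw [← LinearMap.linearIndependent_iff M.mulVecLin hker]
  rfl

lemma rank_schurExtension [Fintype V] (hA : IsUnit (principalBlock D))
    (hsymm : (principalBlock D).IsSymm) :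
    (schurExtension D).rank = Fintype.card {v // p v} := by
  refine le_antisymm ((Matrix.rank_mul_le_right _ _).trans D.rank_le_card_height) ?_
  have h : principalBlock D =
      (schurExtension D).submatrix (Subtype.val : {v // p v} → V) Subtype.val := by
    ext u j
    exact (schurExtension_apply_row hA hsymm u j).symm
  rw [← Matrix.rank_of_isUnit _ hA, h]
  exact Matrix.rank_submatrix_le _ _ _

end PrincipalBlock

/-! ### The outer Laplacian and the rubber band matrix -/

section OuterLaplacian

variable {V : Type*} {G : SimpleGraph V} {H : Finset V}

lemma outerWeight_comm (w : OuterEdge G H → ℝ) (i j : V) :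
    outerWeight w i j = outerWeight w j i := by
  have h : ∀ e f : Sym2 V, e = f →
      (open Classical in if h : e ∈ G.edgeSet ∧ ¬ ∀ v ∈ e, v ∈ H then w ⟨e, h⟩ else 0) =
      (open Classical in if h : f ∈ G.edgeSet ∧ ¬ ∀ v ∈ f, v ∈ H then w ⟨f, h⟩ else 0) := by
    rintro e _ rfl
    rfl
  exact h _ _ Sym2.eq_swap

lemma outerWeight_of_not_adj (w : OuterEdge G H → ℝ) {i j : V} (h : ¬ G.Adj i j) :
    outerWeight w i j = 0 :=
  dif_neg fun h' => h h'.1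

lemma outerWeight_self (w : OuterEdge G H → ℝ) (i : V) : outerWeight w i i = 0 :=
  outerWeight_of_not_adj w (G.loopless.irrefl i)

lemma outerEdge_mk {i j : V} (hi : i ∉ H) (h : G.Adj i j) :
    s(i, j) ∈ G.edgeSet ∧ ¬ ∀ v ∈ s(i, j), v ∈ H :=
  ⟨h, fun h' => hi (h' i (Sym2.mem_mk_left i j))⟩

lemma CarriesWeights.apply_eq [Fintype V] {w : OuterEdge G H → ℝ} {Ω : Matrix V V ℝ}
    (hw : CarriesWeights w Ω) (hΩ : IsWeightMatrix G Ω) {i j : V} (hi : i ∉ H) (hij : i ≠ j) :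
    Ω i j = -outerWeight w i j := by
  by_cases h : G.Adj i j
  · rw [outerWeight, dif_pos (outerEdge_mk hi h)]
    exact hw i j _
  · rw [outerWeight_of_not_adj w h, neg_zero]
    exact hΩ.2.1 i j hij h

/-- The weights that `Ω` carries on the edges outside `H`: the negated entries, each read at an
arbitrary one of the two ordered pairs that represent the edge. -/
noncomputable def weightsOf (G : SimpleGraph V) (H : Finset V) :
    Matrix V V ℝ →ₗ[ℝ] (OuterEdge G H → ℝ) where
  toFun Ω e := -Ω (Quot.out e.1).1 (Quot.out e.1).2
  map_add' Ω Ω' := by ext e; simp [add_comm]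
  map_smul' a Ω := by ext e; simp

lemma carriesWeights_iff {w : OuterEdge G H → ℝ} {Ω : Matrix V V ℝ} (hΩ : Ω.IsSymm) :
    CarriesWeights w Ω ↔ weightsOf G H Ω = w := by
  have hout : ∀ e : OuterEdge G H, s((Quot.out e.1).1, (Quot.out e.1).2) = e.1 :=
    fun e => Quot.out_eq e.1
  constructor
  · intro h
    ext e
    have := h (Quot.out e.1).1 (Quot.out e.1).2 (by rw [hout e]; exact e.2)
    simp only [weightsOf, LinearMap.coe_mk, AddHom.coe_mk, this, neg_neg]
    exact congrArg w (Subtype.ext (hout e))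
  · rintro rfl i j h
    simp only [weightsOf, LinearMap.coe_mk, AddHom.coe_mk, neg_neg]
    rcases Sym2.eq_iff.1 (hout ⟨s(i, j), h⟩) with ⟨h1, h2⟩ | ⟨h1, h2⟩
    · rw [h1, h2]
    · rw [h1, h2, hΩ.apply]

lemma surjective_weightsOf : Function.Surjective (weightsOf G H) := fun w => by
  refine ⟨Matrix.of fun i j => -outerWeight w i j, (carriesWeights_iff ?_).1 ?_⟩
  · ext i j
    simp [outerWeight_comm w i j]
  · intro i j h
    rw [Matrix.of_apply, outerWeight, dif_pos h]

open Classical in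
/-- The rows, at the vertices outside `H`, of the Laplacian of the weights `w`. These are the rows
of every weight matrix that carries the weights `w`. -/
noncomputable def outerLaplacian [Fintype V] (w : OuterEdge G H → ℝ) :
    Matrix {v // v ∉ H} V ℝ :=
  Matrix.of fun u j => if (u : V) = j then ∑ k, outerWeight w u k else -outerWeight w u j

variable [Fintype V]

lemma sum_outerLaplacian_smul {M : Type*} [AddCommGroup M] [Module ℝ M] (w : OuterEdge G H → ℝ)
    (u : {v // v ∉ H}) (x : V → M) :
    ∑ j, outerLaplacian w u j • x j = ∑ j, outerWeight w u j • (x u - x j) := by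
  classical
  have h : ∀ j, outerLaplacian w u j • x j =
      (if (u : V) = j then (∑ k, outerWeight w u k) • x u else 0) - outerWeight w u j • x j := by
    intro j
    simp only [outerLaplacian, Matrix.of_apply]
    split_ifs with hj
    · rw [← hj, outerWeight_self, zero_smul, sub_zero]
    · rw [neg_smul, zero_sub]
  simp only [h, smul_sub, Finset.sum_sub_distrib, Finset.sum_ite_eq, Finset.mem_univ, if_true,
    Finset.sum_smul]

lemma sum_outerLaplacian (w : OuterEdge G H → ℝ) (u : {v // v ∉ H}) :
    ∑ j, outerLaplacian w u j = 0 := by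
  have := sum_outerLaplacian_smul w u (fun _ => (1 : ℝ))
  simpa using this

lemma outerLaplacian_of_not_adj (w : OuterEdge G H → ℝ) (u : {v // v ∉ H}) {j : V}
    (hj : (u : V) ≠ j) (h : ¬ G.Adj u j) : outerLaplacian w u j = 0 := by
  simp [outerLaplacian, hj, outerWeight_of_not_adj w h]

lemma isSymm_principalBlock_outerLaplacian (w : OuterEdge G H → ℝ) :
    (principalBlock (outerLaplacian w)).IsSymm := by
  classical
  ext u v
  simp only [Matrix.transpose_apply, Matrix.submatrix_apply, id_eq, outerLaplacian, Matrix.of_apply]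
  by_cases h : u = v
  · rw [h]
  · rw [if_neg fun h' => h (Subtype.ext h'.symm), if_neg fun h' => h (Subtype.ext h'),
      outerWeight_comm]

lemma CarriesWeights.outerLaplacian_eq {w : OuterEdge G H → ℝ} {Ω : Matrix V V ℝ}
    (hw : CarriesWeights w Ω) (hΩ : IsWeightMatrix G Ω) :
    outerLaplacian w = Ω.submatrix Subtype.val id := by
  classical
  ext u j
  simp only [outerLaplacian, Matrix.of_apply, Matrix.submatrix_apply, id_eq]
  split_ifs with hj
  · have h1 := hΩ.2.2 u
    rw [← Finset.add_sum_erase _ _ (Finset.mem_univ (u : V))] at h1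
    rw [← Finset.add_sum_erase _ _ (Finset.mem_univ (u : V)), outerWeight_self, zero_add, ← hj,
      eq_neg_of_add_eq_zero_left h1, ← Finset.sum_neg_distrib]
    refine Finset.sum_congr rfl fun k hk => ?_
    rw [hw.apply_eq hΩ u.2 (Finset.ne_of_mem_erase hk).symm, neg_neg]
  · exact (hw.apply_eq hΩ u.2 hj).symm

open Classical in
/-- The matrix produced by the rubber band construction from the weights `w`. -/
noncomputable def rubberBandMatrix (w : OuterEdge G H → ℝ) : Matrix V V ℝ :=
  schurExtension (outerLaplacian w)

/-- The weights for which any `n - |H|` columns of the outer Laplacian are independent. -/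
def generalWeights (G : SimpleGraph V) (H : Finset V) : Set (OuterEdge G H → ℝ) :=
  {w | ∀ J : Finset V, J.card + H.card = Fintype.card V →
    LinearIndependent ℝ (fun j : J => (outerLaplacian w).col j)}

section

variable {w : OuterEdge G H → ℝ}

open Classical in
lemma card_compl_add_card (H : Finset V) :
    (Finset.univ.filter fun v => v ∉ H).card + H.card = Fintype.card V := by
  have := Finset.card_filter_add_card_filter_not (s := (Finset.univ : Finset V)) (fun v => v ∈ H)
  simp only [Finset.filter_mem_eq_inter, Finset.univ_inter, Finset.card_univ] at this
  omega

/-- The vertices outside `H` index one of the sets of columns that are independent for general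
weights. -/
lemma linearIndependent_compl {K M : Type*} [Field K] [AddCommGroup M] [Module K M] {f : V → M}
    (h : ∀ J : Finset V, J.card + H.card = Fintype.card V →
      LinearIndependent K (fun j : J => f j)) :
    LinearIndependent K (fun u : {v // v ∉ H} => f u) := by
  classical
  refine (h _ (card_compl_add_card H)).comp
    (fun u : {v // v ∉ H} => ⟨u, by simpa using u.2⟩) fun u v huv => ?_
  simpa [Subtype.ext_iff] using huv

open Classical in
lemma isUnit_principalBlock_of_mem_generalWeights (hw : w ∈ generalWeights G H) :
    IsUnit (principalBlock (outerLaplacian w)) := by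
  rw [← Matrix.linearIndependent_cols_iff_isUnit]
  exact linearIndependent_compl hw

lemma isWeightMatrix_rubberBandMatrix (hH : G.IsClique H) (hw : w ∈ generalWeights G H) :
    IsWeightMatrix G (rubberBandMatrix w) := by
  classical
  have hA := isUnit_principalBlock_of_mem_generalWeights hw
  have hs := isSymm_principalBlock_outerLaplacian w
  have hsymm : (rubberBandMatrix w).IsSymm := isSymm_schurExtension hs
  refine ⟨hsymm, fun i j hij hadj => ?_, fun i => ?_⟩
  · by_cases hi : i ∈ H
    · by_cases hj : j ∈ H
      · exact absurd (hH hi hj hij) hadj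
      · rw [← hsymm.apply]
        exact (schurExtension_apply_row hA hs ⟨j, hj⟩ i).trans
          (outerLaplacian_of_not_adj w ⟨j, hj⟩ hij.symm fun h => hadj h.symm)
    · exact (schurExtension_apply_row hA hs ⟨i, hi⟩ j).trans
        (outerLaplacian_of_not_adj w ⟨i, hi⟩ hij hadj)
  · have h1 : (outerLaplacian w).mulVec (fun _ => 1) = 0 := by
      ext u
      simpa [Matrix.mulVec, dotProduct] using sum_outerLaplacian w u
    have h2 : (rubberBandMatrix w).mulVec (fun _ => 1) = 0 := by
      rw [rubberBandMatrix, schurExtension, ← Matrix.mulVec_mulVec, h1, Matrix.mulVec_zero]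
    simpa [Matrix.mulVec, dotProduct] using congrFun h2 i

lemma carriesWeights_rubberBandMatrix (hw : w ∈ generalWeights G H) :
    CarriesWeights w (rubberBandMatrix w) := by
  classical
  have hA := isUnit_principalBlock_of_mem_generalWeights hw
  have hs := isSymm_principalBlock_outerLaplacian w
  have hrow : ∀ i j (h : s(i, j) ∈ G.edgeSet ∧ ¬ ∀ v ∈ s(i, j), v ∈ H), i ∉ H →
      rubberBandMatrix w i j = -w ⟨s(i, j), h⟩ := by
    intro i j h hi
    have hij : i ≠ j := h.1.ne
    refine (schurExtension_apply_row hA hs ⟨i, hi⟩ j).trans ?_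
    simp only [outerLaplacian, Matrix.of_apply, if_neg hij]
    rw [outerWeight, dif_pos h]
  intro i j h
  by_cases hi : i ∈ H
  · have hj : j ∉ H := fun hj => h.2 fun v hv => by
      rcases Sym2.mem_iff.1 hv with rfl | rfl <;> assumption
    have h' : s(j, i) ∈ G.edgeSet ∧ ¬ ∀ v ∈ s(j, i), v ∈ H := by rwa [Sym2.eq_swap]
    have hsymm : (rubberBandMatrix w).IsSymm := isSymm_schurExtension hs
    rw [← hsymm.apply]
    refine (hrow j i h' hj).trans ?_
    rw [neg_inj]
    exact congrArg w (Subtype.ext Sym2.eq_swap)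
  · exact hrow i j h hi

lemma rubberBandMatrix_mem_Gstr {d : ℕ} (hH : G.IsNClique (d + 1) H)
    (hw : w ∈ generalWeights G H) : rubberBandMatrix w ∈ Gstr G d := by
  classical
  have hA := isUnit_principalBlock_of_mem_generalWeights hw
  refine ⟨isWeightMatrix_rubberBandMatrix hH.isClique hw, ?_, fun J hJ => ?_⟩
  · rw [rubberBandMatrix, rank_schurExtension hA (isSymm_principalBlock_outerLaplacian w),
      Fintype.card_subtype, ← hH.card_eq, card_compl_add_card]
  · exact (linearIndependent_col_schurExtension_iff hA _).2 (hw J (by rwa [hH.card_eq]))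

/-- A general position stress matrix is recovered from its weights at the edges outside `H`. -/
lemma rubberBandMatrix_weightsOf {d : ℕ} (hH : G.IsNClique (d + 1) H) {Ω : Matrix V V ℝ}
    (hΩ : Ω ∈ Gstr G d) :
    weightsOf G H Ω ∈ generalWeights G H ∧ rubberBandMatrix (weightsOf G H Ω) = Ω := by
  classical
  obtain ⟨hW, hrank, hli⟩ := hΩ
  have hcarry : CarriesWeights (weightsOf G H Ω) Ω := (carriesWeights_iff hW.1).2 rfl
  have hD := hcarry.outerLaplacian_eq hW
  have hli' := linearIndependent_compl (H := H) (K := ℝ) (f := Ω.col)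
    (fun J hJ => hli J (by rwa [← hH.card_eq]))
  obtain ⟨hA, heq⟩ := hW.1.eq_mul_inv_mul_of_rank_eq (p := fun v => v ∉ H) (by
    have := card_compl_add_card H
    rw [hH.card_eq] at this
    rw [Fintype.card_subtype]
    omega) hli'
  have hΩ' : rubberBandMatrix (weightsOf G H Ω) = Ω := by
    rw [rubberBandMatrix, hD]
    exact heq.symm
  refine ⟨fun J hJ => ?_, hΩ'⟩
  have hA' : IsUnit (principalBlock (outerLaplacian (weightsOf G H Ω))) := by
    rw [hD]; exact hA
  rw [← linearIndependent_col_schurExtension_iff hA']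
  change LinearIndependent ℝ fun j : J => (rubberBandMatrix (weightsOf G H Ω)).col j
  rw [hΩ']
  exact hli J (by rwa [← hH.card_eq])

lemma weightsOf_rubberBandMatrix (hH : G.IsClique H) (hw : w ∈ generalWeights G H) :
    weightsOf G H (rubberBandMatrix w) = w :=
  (carriesWeights_iff (isWeightMatrix_rubberBandMatrix hH hw).1).1
    (carriesWeights_rubberBandMatrix hw)

lemma bijOn_rubberBandMatrix {d : ℕ} (hH : G.IsNClique (d + 1) H) :
    Set.BijOn rubberBandMatrix (generalWeights G H) (Gstr G d) :=
  ⟨fun _ hw => rubberBandMatrix_mem_Gstr hH hw,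
    fun w hw w' hw' h => by
      rw [← weightsOf_rubberBandMatrix hH.isClique hw, h,
        weightsOf_rubberBandMatrix hH.isClique hw'],
    fun _ hΩ => ⟨_, rubberBandMatrix_weightsOf hH hΩ⟩⟩

end

end OuterLaplacian

/-! ### Rubber band configurations -/

section RubberBand

variable {V : Type*} [Fintype V] {G : SimpleGraph V} {H : Finset V}

lemma linearIndependent_col_finset_iff {ι K : Type*} [Field K] {D : Matrix ι V K} {J : Finset V} :
    LinearIndependent K (fun j : J => D.col j) ↔
      ∀ x : V → K, (∀ v, v ∉ J → x v = 0) → (∀ u, ∑ j, D u j * x j = 0) → x = 0 := by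
  classical
  rw [Fintype.linearIndependent_iff]
  constructor
  · intro h x hx hDx
    have key := h (fun j => x j) (by
      ext u
      have : ∑ j ∈ J, D u j * x j = 0 := by
        rw [← hDx u]
        exact Finset.sum_subset (Finset.subset_univ _) fun v _ hv => by rw [hx v hv, mul_zero]
      rw [← Finset.sum_coe_sort] at this
      simpa [mul_comm] using this)
    ext v
    by_cases hv : v ∈ J
    · exact key ⟨v, hv⟩
    · exact hx v hv
  · intro h g hg j
    have hx := h (fun v => if hv : v ∈ J then g ⟨v, hv⟩ else 0) (fun v hv => dif_neg hv)
      fun u => by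
        have := congrFun hg u
        simp only [Finset.sum_apply, Pi.smul_apply, Matrix.col_apply, smul_eq_mul,
          Pi.zero_apply] at this
        refine Eq.trans ?_ this
        rw [← Finset.sum_subset (Finset.subset_univ J) fun v _ hv => by
          rw [dif_neg hv, mul_zero], ← Finset.sum_coe_sort]
        refine Finset.sum_congr rfl fun i _ => ?_
        rw [dif_pos i.2, mul_comm]
    have := congrFun hx j
    simpa using this

variable {w : OuterEdge G H → ℝ}

lemma eq_zero_of_sum_outerLaplacian_mul_eq_zero (hw : w ∈ generalWeights G H) {x : V → ℝ}
    (hx : ∀ v ∈ H, x v = 0) (hD : ∀ u, ∑ j, outerLaplacian w u j * x j = 0) : x = 0 := by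
  classical
  exact linearIndependent_col_finset_iff.1 (hw _ (card_compl_add_card H)) x
    (fun v hv => hx v (by simpa using hv)) hD

lemma isRubberBand_iff {d : ℕ} {q : H → EuclideanSpace ℝ (Fin d)}
    {p : V → EuclideanSpace ℝ (Fin d)} :
    IsRubberBand w q p ↔ (∀ i : H, p i = q i) ∧ ∀ u, ∑ j, outerLaplacian w u j • p j = 0 := by
  refine and_congr_right fun _ => ⟨fun h u => ?_, fun h i hi => ?_⟩
  · rw [sum_outerLaplacian_smul]
    exact h u u.2
  · rw [← sum_outerLaplacian_smul w ⟨i, hi⟩]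
    exact h ⟨i, hi⟩

/-- The rubber band configuration exists and is unique, as the linear system for it is square and
nonsingular. -/
lemma existsUnique_isRubberBand (hw : w ∈ generalWeights G H) {d : ℕ}
    (q : H → EuclideanSpace ℝ (Fin d)) : ∃! p, IsRubberBand w q p := by
  classical
  let Φ : (V → EuclideanSpace ℝ (Fin d)) →ₗ[ℝ] (V → EuclideanSpace ℝ (Fin d)) :=
    { toFun := fun p i => if h : i ∈ H then p i else ∑ j, outerLaplacian w ⟨i, h⟩ j • p j
      map_add' := fun p p' => by
        ext1 i
        by_cases h : i ∈ H <;> simp [h, Finset.sum_add_distrib]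
      map_smul' := fun a p => by
        ext1 i
        by_cases h : i ∈ H
        · simp [h]
        · simp [h, Finset.smul_sum, smul_comm a] }
  have hΦ : ∀ p p₀, Φ p = p₀ ↔ (∀ i : H, p i = p₀ i) ∧
      ∀ u : {v // v ∉ H}, ∑ j, outerLaplacian w u j • p j = p₀ u := by
    intro p p₀
    constructor
    · rintro rfl
      exact ⟨fun i => by simp [Φ], fun u => by simp [Φ, u.2]⟩
    · rintro ⟨h1, h2⟩
      ext1 i
      by_cases h : i ∈ H
      · simpa [Φ, h] using h1 ⟨i, h⟩
      · simpa [Φ, h] using h2 ⟨i, h⟩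
  have hinj : Function.Injective Φ := by
    rw [injective_iff_map_eq_zero]
    intro p hp
    obtain ⟨h1, h2⟩ := (hΦ p 0).1 hp
    ext v l
    refine congrFun (eq_zero_of_sum_outerLaplacian_mul_eq_zero hw (x := fun v => p v l)
      (fun v hv => ?_) fun u => ?_) v
    · rw [h1 ⟨v, hv⟩]; rfl
    · have := congrArg (fun y : EuclideanSpace ℝ (Fin d) => y l) (h2 u)
      simpa using this
  let p₀ : V → EuclideanSpace ℝ (Fin d) := fun i => if h : i ∈ H then q ⟨i, h⟩ else 0
  have hiff : ∀ p, IsRubberBand w q p ↔ Φ p = p₀ := fun p => by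
    rw [isRubberBand_iff, hΦ]
    refine and_congr (forall_congr' fun i => by simp [p₀]) (forall_congr' fun u => ?_)
    simp [p₀, u.2]
  obtain ⟨p, hp⟩ := LinearMap.injective_iff_surjective.1 hinj p₀
  exact ⟨p, (hiff p).2 hp, fun p' hp' => hinj (((hiff p').1 hp').trans hp.symm)⟩

lemma isStressMatrixOf_iff {d : ℕ} {p : V → EuclideanSpace ℝ (Fin d)} {Ω : Matrix V V ℝ} :
    IsStressMatrixOf G p Ω ↔ IsWeightMatrix G Ω ∧ ∀ i, ∑ j, Ω i j • p j = 0 := by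
  refine and_congr_right fun h => forall_congr' fun i => ?_
  simp only [smul_sub, Finset.sum_sub_distrib]
  rw [← Finset.sum_smul, h.2.2 i, zero_smul, zero_sub, neg_eq_zero]

lemma sum_rubberBandMatrix_smul_eq_zero {M : Type*} [AddCommGroup M] [Module ℝ M] {p : V → M}
    (hp : ∀ u, ∑ j, outerLaplacian w u j • p j = 0) (i : V) :
    ∑ j, rubberBandMatrix w i j • p j = 0 := by
  classical
  simp only [rubberBandMatrix, schurExtension]
  rw [Finset.sum_congr rfl fun j _ => by rw [Matrix.mul_apply, Finset.sum_smul], Finset.sum_comm]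
  refine Finset.sum_eq_zero fun u _ => ?_
  simp only [mul_smul]
  rw [← Finset.smul_sum, hp, smul_zero]

/-- The rubber band matrix is the only stress matrix of the rubber band configuration that carries
the weights `w`: the entries at pairs in `H` are forced by the affine independence of the pins. -/
lemma isRubberBandStress_rubberBandMatrix {d : ℕ} (hH : G.IsClique H)
    (hw : w ∈ generalWeights G H) : IsRubberBandStress d w (rubberBandMatrix w) := by
  classical
  intro q hq
  obtain ⟨p, hp, huniq⟩ := existsUnique_isRubberBand hw q
  refine ⟨p, fun p' => ⟨huniq p', fun h => h ▸ hp⟩, fun Ω' => ⟨?_, ?_⟩⟩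
  · rintro ⟨hstress, hcarry⟩
    obtain ⟨hpq, hD⟩ := isRubberBand_iff.1 hp
    obtain ⟨hW', h0'⟩ := isStressMatrixOf_iff.1 hstress
    have hW := isWeightMatrix_rubberBandMatrix hH hw
    have h0 := sum_rubberBandMatrix_smul_eq_zero hD
    have hrow : ∀ i, i ∉ H → ∀ j, Ω' i j = rubberBandMatrix w i j := fun i hi j => by
      have h1 := hcarry.outerLaplacian_eq hW'
      rw [(carriesWeights_rubberBandMatrix hw).outerLaplacian_eq hW] at h1
      exact (congrFun (congrFun h1 ⟨i, hi⟩) j).symm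
    have hcol : ∀ i j, j ∉ H → Ω' i j - rubberBandMatrix w i j = 0 := fun i j hj => by
      rw [← hW'.1.apply, ← hW.1.apply, hrow j hj, sub_self]
    ext i j
    by_cases hj : j ∈ H
    · have h1 : ∑ h : H, (Ω' i h - rubberBandMatrix w i h) = 0 := by
        rw [Finset.sum_coe_sort H fun h => Ω' i h - rubberBandMatrix w i h,
          Finset.sum_subset (Finset.subset_univ H) fun v _ hv => hcol i v hv,
          Finset.sum_sub_distrib, hW'.2.2, hW.2.2, sub_zero]
      have h2 : ∑ h : H, (Ω' i h - rubberBandMatrix w i h) • q h = 0 := by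
        simp only [← hpq]
        rw [Finset.sum_coe_sort H fun h => (Ω' i h - rubberBandMatrix w i h) • p h,
          Finset.sum_subset (Finset.subset_univ H) fun v _ hv => by rw [hcol i v hv, zero_smul]]
        simp only [sub_smul, Finset.sum_sub_distrib]
        rw [h0', h0, sub_zero]
      exact sub_eq_zero.1 (affineIndependent_iff.1 hq Finset.univ _ h1 h2 ⟨j, hj⟩
        (Finset.mem_univ _))
    · exact sub_eq_zero.1 (hcol i j hj)
  · rintro rfl
    exact ⟨isStressMatrixOf_iff.2 ⟨isWeightMatrix_rubberBandMatrix hH hw,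
      sum_rubberBandMatrix_smul_eq_zero (isRubberBand_iff.1 hp).2⟩,
      carriesWeights_rubberBandMatrix hw⟩

end RubberBand

/-! ### The weights in general position form a non-empty Zariski open set -/

section GeneralWeights

variable {V : Type*} [Fintype V] {G : SimpleGraph V} {H : Finset V}

/-- The entries of the outer Laplacian are polynomials in the weights. -/
lemma exists_polynomial_outerLaplacian (G : SimpleGraph V) (H : Finset V) :
    ∃ D : Matrix {v // v ∉ H} V (MvPolynomial (OuterEdge G H) ℝ),
      ∀ w, outerLaplacian w = D.map (MvPolynomial.eval w) := by
  classical
  have hex : ∀ i j : V, ∃ f : MvPolynomial (OuterEdge G H) ℝ,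
      ∀ w, outerWeight w i j = MvPolynomial.eval w f := fun i j => by
    by_cases h : s(i, j) ∈ G.edgeSet ∧ ¬ ∀ v ∈ s(i, j), v ∈ H
    · exact ⟨MvPolynomial.X ⟨_, h⟩, fun w => by rw [outerWeight, dif_pos h, MvPolynomial.eval_X]⟩
    · exact ⟨0, fun w => by rw [outerWeight, dif_neg h, map_zero]⟩
  choose f hf using hex
  refine ⟨Matrix.of fun u j => if (u : V) = j then ∑ k, f u k else -f u j, fun w => ?_⟩
  ext u j
  simp only [outerLaplacian, Matrix.of_apply, Matrix.map_apply]
  split_ifs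
  · simp [hf]
  · simp [hf]

lemma isRationalOn_rubberBandMatrix (i j : V) :
    IsRationalOn (generalWeights G H) (fun w => rubberBandMatrix w i j) := by
  classical
  obtain ⟨D, hD⟩ := exists_polynomial_outerLaplacian G H
  let A : Matrix {v // v ∉ H} {v // v ∉ H} (MvPolynomial (OuterEdge G H) ℝ) :=
    D.submatrix id Subtype.val
  have hA : ∀ w, principalBlock (outerLaplacian w) = A.map (MvPolynomial.eval w) := fun w => by
    rw [hD]; rfl
  refine ⟨(D.transpose * A.adjugate * D) i j, A.det, fun w hw => ?_⟩
  have hdet : MvPolynomial.eval w A.det = (principalBlock (outerLaplacian w)).det := by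
    rw [hA, RingHom.map_det]; rfl
  have hne : (principalBlock (outerLaplacian w)).det ≠ 0 :=
    ((Matrix.isUnit_iff_isUnit_det _).1 (isUnit_principalBlock_of_mem_generalWeights hw)).ne_zero
  have hadj : A.adjugate.map (MvPolynomial.eval w) =
      (principalBlock (outerLaplacian w)).adjugate := by
    rw [hA]
    exact RingHom.map_adjugate (MvPolynomial.eval w) A
  have hnum : MvPolynomial.eval w ((D.transpose * A.adjugate * D) i j) =
      ((outerLaplacian w).transpose * (principalBlock (outerLaplacian w)).adjugate *
        outerLaplacian w) i j := by
    rw [← hadj, hD, ← Matrix.transpose_map, ← Matrix.map_mul, ← Matrix.map_mul, Matrix.map_apply]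
  rw [hdet, hnum]
  refine ⟨hne, ?_⟩
  simp only [rubberBandMatrix, schurExtension]
  rw [Matrix.inv_def, Ring.inverse_eq_inv', Matrix.mul_smul, Matrix.smul_mul, Matrix.smul_apply,
    smul_eq_mul, div_eq_inv_mul]

/-- For every set `J` of `n - k` columns some weights make these columns independent: take weight
`1` on the edges inside the classes of a partition into connected sets that each contain one vertex
of `H` and one vertex outside `J`. -/
lemma IsVertexConnected.exists_linearIndependent_outerLaplacian {k : ℕ}
    (hG : IsVertexConnected G k) (hk : 0 < k) (hH : H.card = k) {J : Finset V}
    (hJ : J.card + H.card = Fintype.card V) :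
    ∃ w : OuterEdge G H → ℝ, LinearIndependent ℝ (fun j : J => (outerLaplacian w).col j) := by
  classical
  have hI : Jᶜ.card = k := by
    rw [Finset.card_compl]; omega
  obtain ⟨c, hcH, hc, hreach, hcI⟩ := hG.exists_partition hk hH hI
  let w : OuterEdge G H → ℝ := fun e => if e.1 ∈ (fiberGraph G c).edgeSet then 1 else 0
  have hw : ∀ i j, outerWeight w i j = if (fiberGraph G c).Adj i j then 1 else 0 := by
    intro i j
    by_cases h : s(i, j) ∈ G.edgeSet ∧ ¬ ∀ v ∈ s(i, j), v ∈ H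
    · rw [outerWeight, dif_pos h]
      simp only [w, SimpleGraph.mem_edgeSet]
    · rw [outerWeight, dif_neg h, if_neg]
      intro hadj
      refine h ⟨hadj.1, fun hall => hadj.ne ?_⟩
      rw [← hc i (hall i (Sym2.mem_mk_left i j)), hadj.2, hc j (hall j (Sym2.mem_mk_right i j))]
  refine ⟨w, linearIndependent_col_finset_iff.2 fun x hx hDx => ?_⟩
  have hconst := eq_comp_of_harmonic_fiberGraph hcH hc hreach (x := x) fun u hu => by
    have := sum_outerLaplacian_smul w ⟨u, hu⟩ x
    simp only [smul_eq_mul, hDx, hw, ite_mul, one_mul, zero_mul] at this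
    exact this.symm
  ext v
  obtain ⟨a, ha, hav⟩ := hcI (c v) (hcH v)
  rw [hconst v, ← hav, ← hconst a, hx a (Finset.mem_compl.1 ha)]
  rfl

/-- The general weights are the non-zeros of a non-zero polynomial. -/
lemma IsVertexConnected.exists_polynomial_generalWeights {k : ℕ}
    (hG : IsVertexConnected G k) (hk : 0 < k) (hH : H.card = k) :
    ∃ f : MvPolynomial (OuterEdge G H) ℝ, f ≠ 0 ∧
      generalWeights G H = {w | MvPolynomial.eval w f ≠ 0} := by
  classical
  obtain ⟨D, hD⟩ := exists_polynomial_outerLaplacian G H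
  have hex : ∀ J : Finset V, ∃ f : MvPolynomial (OuterEdge G H) ℝ, f ≠ 0 ∧
      ∀ w, MvPolynomial.eval w f ≠ 0 ↔ (J.card + H.card = Fintype.card V →
        LinearIndependent ℝ (fun j : J => (outerLaplacian w).col j)) := by
    intro J
    by_cases hJ : J.card + H.card = Fintype.card V
    · have hcard : Fintype.card {v // v ∉ H} = Fintype.card J := by
        rw [Fintype.card_subtype, Fintype.card_coe]
        have := card_compl_add_card H
        omega
      let e : {v // v ∉ H} ≃ J := Fintype.equivOfCardEq hcard
      let B : Matrix {v // v ∉ H} {v // v ∉ H} (MvPolynomial (OuterEdge G H) ℝ) :=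
        D.submatrix id fun v => e v
      have hiff : ∀ w, MvPolynomial.eval w B.det ≠ 0 ↔
          LinearIndependent ℝ (fun j : J => (outerLaplacian w).col j) := by
        intro w
        rw [← linearIndependent_equiv e, RingHom.map_det, ← isUnit_iff_ne_zero,
          ← Matrix.isUnit_iff_isUnit_det, ← Matrix.linearIndependent_cols_iff_isUnit, hD]
        rfl
      refine ⟨B.det, fun h0 => ?_, fun w => by rw [hiff]; exact ⟨fun h _ => h, fun h => h hJ⟩⟩
      obtain ⟨w, hw⟩ := hG.exists_linearIndependent_outerLaplacian hk hH hJ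
      exact (hiff w).2 hw (by rw [h0, map_zero])
    · exact ⟨1, one_ne_zero, fun w => by simp [hJ]⟩
  choose f hf0 hf using hex
  refine ⟨∏ J, f J, Finset.prod_ne_zero_iff.2 fun J _ => hf0 J, ?_⟩
  ext w
  simp only [generalWeights, Set.mem_ofPred_eq, map_prod, Finset.prod_ne_zero_iff, Finset.mem_univ,
    true_implies, hf]

end GeneralWeights

/-! ### Rational maps -/

section Rational

variable {σ τ : Type*}

lemma isRationalOn_eval {X : Set (σ → ℝ)} {φ : (σ → ℝ) → τ → ℝ}
    (hφ : ∀ i, IsRationalOn X (fun x => φ x i)) (P : MvPolynomial τ ℝ) :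
    IsRationalOn X (fun x => MvPolynomial.eval (φ x) P) := by
  induction P using MvPolynomial.induction_on with
  | C a => exact ⟨MvPolynomial.C a, 1, fun x _ => by simp⟩
  | add p q hp hq =>
    obtain ⟨f, g, h⟩ := hp
    obtain ⟨f', g', h'⟩ := hq
    refine ⟨f * g' + g * f', g * g', fun x hx => ?_⟩
    obtain ⟨h1, h2 : MvPolynomial.eval (φ x) p = _⟩ := h x hx
    obtain ⟨h3, h4 : MvPolynomial.eval (φ x) q = _⟩ := h' x hx
    simp only [map_mul, map_add]
    exact ⟨mul_ne_zero h1 h3, by rw [h2, h4, div_add_div _ _ h1 h3]⟩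
  | mul_X p i hp =>
    obtain ⟨f, g, h⟩ := hp
    obtain ⟨f', g', h'⟩ := hφ i
    refine ⟨f * f', g * g', fun x hx => ?_⟩
    obtain ⟨h1, h2 : MvPolynomial.eval (φ x) p = _⟩ := h x hx
    obtain ⟨h3, h4 : φ x i = _⟩ := h' x hx
    simp only [map_mul, MvPolynomial.eval_X]
    exact ⟨mul_ne_zero h1 h3, by rw [h2, h4, div_mul_div_comm]⟩

lemma MvPolynomial.exists_eval_ne_zero {f : MvPolynomial σ ℝ} (hf : f ≠ 0) :
    ∃ x, MvPolynomial.eval x f ≠ 0 := by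
  by_contra! h
  exact hf (MvPolynomial.funext fun x => by rw [h x, map_zero])

lemma isZariskiOpen_setOf_eval_ne_zero (f : MvPolynomial σ ℝ) :
    IsZariskiOpen {x | MvPolynomial.eval x f ≠ 0} :=
  ⟨{f}, by ext x; simp⟩

/-- The image of a non-empty basic Zariski open set under a rational map is irreducible. -/
lemma isIrreducibleZariski_image {f : MvPolynomial σ ℝ} (hf : f ≠ 0) {φ : (σ → ℝ) → τ → ℝ}
    (hφ : ∀ i, IsRationalOn {x | MvPolynomial.eval x f ≠ 0} (fun x => φ x i)) :
    IsIrreducibleZariski (φ '' {x | MvPolynomial.eval x f ≠ 0}) := by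
  obtain ⟨x₀, hx₀⟩ := MvPolynomial.exists_eval_ne_zero hf
  refine ⟨⟨φ x₀, x₀, hx₀, rfl⟩, fun A B hA hB hAB => ?_⟩
  set S := φ '' {x | MvPolynomial.eval x f ≠ 0} with hS
  have hSAB : S ⊆ A ∪ B := hAB ▸ Set.subset_sInter fun _ h => h.2
  have key : S ⊆ A ∨ S ⊆ B := by
    by_contra! hno
    obtain ⟨hnA, hnB⟩ := hno
    obtain ⟨F, hF⟩ := id hA
    obtain ⟨F', hF'⟩ := id hB
    obtain ⟨_, ⟨a, ha, rfl⟩, haA⟩ := Set.not_subset.1 hnA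
    obtain ⟨_, ⟨b, hb, rfl⟩, hbB⟩ := Set.not_subset.1 hnB
    obtain ⟨p, hp, hpa⟩ : ∃ p ∈ F, MvPolynomial.eval (φ a) p ≠ 0 := by
      by_contra! h; exact haA (hF ▸ h)
    obtain ⟨q, hq, hqb⟩ : ∃ q ∈ F', MvPolynomial.eval (φ b) q ≠ 0 := by
      by_contra! h; exact hbB (hF' ▸ h)
    obtain ⟨n, m, hnm⟩ := isRationalOn_eval hφ p
    obtain ⟨n', m', hnm'⟩ := isRationalOn_eval hφ q
    have hn : n ≠ 0 := by
      rintro rfl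
      exact hpa ((hnm a ha).2.trans (by rw [map_zero, zero_div]))
    have hn' : n' ≠ 0 := by
      rintro rfl
      exact hqb ((hnm' b hb).2.trans (by rw [map_zero, zero_div]))
    -- where the numerators and `f` do not vanish, the image avoids both `A` and `B`
    obtain ⟨x, hx⟩ := MvPolynomial.exists_eval_ne_zero (mul_ne_zero (mul_ne_zero hn hn') hf)
    simp only [map_mul, mul_ne_zero_iff] at hx
    obtain ⟨⟨hx1, hx2⟩, hxf⟩ := hx
    rcases hSAB ⟨x, hxf, rfl⟩ with h | h
    · rw [hF] at h
      exact div_ne_zero hx1 (hnm x hxf).1 ((hnm x hxf).2.symm.trans (h p hp))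
    · rw [hF'] at h
      exact div_ne_zero hx2 (hnm' x hxf).1 ((hnm' x hxf).2.symm.trans (h q hq))
  have hmin : ∀ C, IsAlgebraicSet C → S ⊆ C → C ⊆ A ∪ B → zariskiClosure S = C :=
    fun C hC hSC hCAB =>
      (Set.sInter_subset_of_mem (show C ∈ {A | IsAlgebraicSet A ∧ S ⊆ A} from ⟨hC, hSC⟩)).antisymm
        (hCAB.trans hAB.ge)
  exact key.imp (fun h => hmin A hA h Set.subset_union_left)
    fun h => hmin B hB h Set.subset_union_right

lemma MvPolynomial.contDiff_eval [Fintype σ] (f : MvPolynomial σ ℝ) :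
    ContDiff ℝ ∞ (fun x : σ → ℝ => MvPolynomial.eval x f) := by
  induction f using MvPolynomial.induction_on with
  | C a => simpa using contDiff_const
  | add p q hp hq => simpa using hp.add hq
  | mul_X p i hp => simpa using hp.mul (contDiff_apply ℝ ℝ i)

lemma IsRationalOn.contDiffOn [Fintype σ] {X : Set (σ → ℝ)} {φ : (σ → ℝ) → ℝ}
    (h : IsRationalOn X φ) : ContDiffOn ℝ ∞ φ X := by
  obtain ⟨f, g, hfg⟩ := h
  exact (f.contDiff_eval.contDiffOn.div g.contDiff_eval.contDiffOn fun x hx => (hfg x hx).1).congr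
    fun x hx => (hfg x hx).2

end Rational

/-! ### The dimension of the image of a smooth section -/

section Dimension

variable {E F : Type*} [NormedAddCommGroup E] [NormedSpace ℝ E]
  [NormedAddCommGroup F] [NormedSpace ℝ F] [FiniteDimensional ℝ F]
  {π : E →L[ℝ] F} {ρ : F → E} {X : Set F}

/-- The image of a smooth section `ρ` of a linear map `π` is straightened by the shear
`y ↦ y - ρ (π y) + ι (π y)`, where `ι` is a linear section of `π`. -/
lemma isSmoothSubmanifold_image_of_section (hX : IsOpen X) (hρ : ContDiffOn ℝ ∞ ρ X)
    (hπρ : ∀ w ∈ X, π (ρ w) = w) (hπ : Function.Surjective π) :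
    IsSmoothSubmanifold (Module.finrank ℝ F) (ρ '' X) := by
  obtain ⟨ι₀, hι₀⟩ := π.toLinearMap.exists_rightInverse_of_surjective (LinearMap.range_eq_top.2 hπ)
  let ι : F →L[ℝ] E := LinearMap.toContinuousLinearMap ι₀
  have hπι : ∀ w, π (ι w) = w := fun w => LinearMap.congr_fun hι₀ w
  have hρπ : ContDiffOn ℝ ∞ (fun y => ρ (π y)) (π ⁻¹' X) :=
    hρ.comp π.contDiff.contDiffOn fun _ h => h
  have hιπ : ContDiffOn ℝ ∞ (fun y => ι (π y)) (π ⁻¹' X) :=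
    (ι.contDiff.comp π.contDiff).contDiffOn
  have h1 : ContDiffOn ℝ ∞ (fun y => y - ρ (π y) + ι (π y)) (π ⁻¹' X) :=
    (contDiffOn_id.sub hρπ).add hιπ
  have h2 : ContDiffOn ℝ ∞ (fun z => z + ρ (π z) - ι (π z)) (π ⁻¹' X) :=
    (contDiffOn_id.add hρπ).sub hιπ
  have hopen : IsOpen (π ⁻¹' X) := hX.preimage π.continuous
  have hπ1 : ∀ y, π y ∈ X → π (y - ρ (π y) + ι (π y)) = π y := fun y hy => by
    rw [map_add, map_sub, hπρ _ hy, hπι, sub_self, zero_add]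
  have hπ2 : ∀ z, π z ∈ X → π (z + ρ (π z) - ι (π z)) = π z := fun z hz => by
    rw [map_sub, map_add, hπρ _ hz, hπι, add_sub_cancel_right]
  let e : OpenPartialHomeomorph E E :=
    { toFun := fun y => y - ρ (π y) + ι (π y)
      invFun := fun z => z + ρ (π z) - ι (π z)
      source := π ⁻¹' X
      target := π ⁻¹' X
      map_source' := fun y hy => by rw [Set.mem_preimage, hπ1 y hy]; exact hy
      map_target' := fun z hz => by rw [Set.mem_preimage, hπ2 z hz]; exact hz
      left_inv' := fun y hy => by rw [hπ1 y hy]; abel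
      right_inv' := fun z hz => by rw [hπ2 z hz]; abel
      open_source := hopen
      open_target := hopen
      continuousOn_toFun := h1.continuousOn
      continuousOn_invFun := h2.continuousOn }
  have heρ : ∀ w ∈ X, e (ρ w) = ι w := fun w hw => by
    change ρ w - ρ (π (ρ w)) + ι (π (ρ w)) = ι w
    rw [hπρ w hw, sub_self, zero_add]
  have hρsource : ∀ w ∈ X, ρ w ∈ π ⁻¹' X := fun w hw => by
    rw [Set.mem_preimage, hπρ w hw]; exact hw
  rintro _ ⟨w, hw, rfl⟩
  refine ⟨e, LinearMap.range ι₀, hρsource w hw, h1, h2,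
    LinearMap.finrank_range_of_inj fun a b hab => ?_, ?_⟩
  · rw [← hπι a, ← hπι b]
    exact congrArg π hab
  · ext z
    constructor
    · rintro ⟨_, ⟨-, a, ha, rfl⟩, rfl⟩
      rw [heρ a ha]
      exact ⟨by change π (ι a) ∈ X; rwa [hπι], a, rfl⟩
    · rintro ⟨hz, a, rfl⟩
      have ha : a ∈ X := by
        have : π (ι a) ∈ X := hz
        rwa [hπι] at this
      exact ⟨ρ a, ⟨hρsource a ha, a, ha, rfl⟩, heρ a ha⟩

/-- A submanifold inside the image of a section of `π` embeds by `π`, so that its dimension is at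
most that of the target of `π`: a local parametrization composed with `π` has a differentiable
left inverse, hence an injective derivative. -/
lemma IsSmoothSubmanifold.le_finrank_of_subset_image (hX : IsOpen X) (hρ : ContDiffOn ℝ ∞ ρ X)
    (hπρ : ∀ w ∈ X, π (ρ w) = w) {k : ℕ} {M : Set E} (hM : IsSmoothSubmanifold k M)
    (hne : M.Nonempty) (hMX : M ⊆ ρ '' X) : k ≤ Module.finrank ℝ F := by
  obtain ⟨x, hx⟩ := hne
  obtain ⟨e, L, hxe, he, hesymm, hL, himg⟩ := hM x hx
  obtain ⟨w, hw, rfl⟩ := hMX hx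
  have hl₀ : e (ρ w) ∈ e.target ∩ (L : Set E) := himg ▸ ⟨ρ w, ⟨hxe, hx⟩, rfl⟩
  let l₀ : L := ⟨e (ρ w), hl₀.2⟩
  let φ : L → F := fun l => π (e.symm l)
  let ψ : F → E := fun v => e (ρ v)
  have hφ₀ : φ l₀ = w := by
    change π (e.symm (e (ρ w))) = w
    rw [e.left_inv hxe, hπρ w hw]
  have hφ : DifferentiableAt ℝ φ l₀ := by
    have h1 : DifferentiableAt ℝ e.symm (L.subtypeL l₀) :=
      (hesymm.contDiffAt (e.open_target.mem_nhds hl₀.1)).differentiableAt (by simp)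
    exact π.differentiableAt.comp l₀ (h1.comp l₀ L.subtypeL.differentiableAt)
  have hψ : DifferentiableAt ℝ ψ (φ l₀) := by
    rw [hφ₀]
    have h1 : DifferentiableAt ℝ e (ρ w) :=
      (he.contDiffAt (e.open_source.mem_nhds hxe)).differentiableAt (by simp)
    have h2 : DifferentiableAt ℝ ρ w :=
      (hρ.contDiffAt (hX.mem_nhds hw)).differentiableAt (by simp)
    exact h1.comp w h2
  have hcomp : ψ ∘ φ =ᶠ[nhds l₀] L.subtypeL := by
    have hopen : IsOpen {l : L | (l : E) ∈ e.target} := e.open_target.preimage continuous_subtype_val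
    filter_upwards [hopen.mem_nhds hl₀.1] with l hl
    have hmem : (l : E) ∈ e '' (e.source ∩ M) := himg ▸ ⟨hl, l.2⟩
    obtain ⟨y, ⟨hy, hyM⟩, hyl⟩ := hmem
    obtain ⟨v, hv, rfl⟩ := hMX hyM
    change e (ρ (π (e.symm l))) = l
    rw [← hyl, e.left_inv hy, hπρ v hv]
  have hderiv : (fderiv ℝ ψ (φ l₀)).comp (fderiv ℝ φ l₀) = L.subtypeL := by
    rw [← fderiv_comp l₀ hψ hφ, hcomp.fderiv_eq, ContinuousLinearMap.fderiv]
  rw [← hL]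
  refine LinearMap.finrank_le_finrank_of_injective (f := (fderiv ℝ φ l₀).toLinearMap) ?_
  intro a b hab
  have h := congrArg (fderiv ℝ ψ (φ l₀)) hab
  exact Subtype.ext ((DFunLike.congr_fun hderiv a).symm.trans
    (Eq.trans h (DFunLike.congr_fun hderiv b)))

lemma hasRealDimension_image_of_section (hX : IsOpen X) (hXne : X.Nonempty)
    (hρ : ContDiffOn ℝ ∞ ρ X) (hπρ : ∀ w ∈ X, π (ρ w) = w) (hπ : Function.Surjective π) :
    HasRealDimension (ρ '' X) (Module.finrank ℝ F) := by
  refine ⟨⟨Set.univ, isOpen_univ, ?_, ?_⟩, ?_⟩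
  · rw [Set.univ_inter]; exact hXne.image ρ
  · rw [Set.univ_inter]; exact isSmoothSubmanifold_image_of_section hX hρ hπρ hπ
  · rintro k ⟨U, -, hne, hk⟩
    exact hk.le_finrank_of_subset_image hX hρ hπρ hne Set.inter_subset_right

end Dimension

/-! ### The edges outside a clique -/

open Classical in
lemma SimpleGraph.IsNClique.ncard_edgeSet {V : Type*} [Fintype V] {G : SimpleGraph V}
    {H : Finset V} {k : ℕ} (hH : G.IsNClique k H) :
    G.edgeSet.ncard = Nat.card (OuterEdge G H) + k.choose 2 := by
  have hinner : {e : Sym2 V | e ∈ G.edgeSet ∧ ∀ v ∈ e, v ∈ H} =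
      (H.offDiag.image Sym2.mk.uncurry : Finset (Sym2 V)) := by
    ext e
    induction e using Sym2.ind with
    | _ a b =>
      simp only [Set.mem_ofPred_eq, SimpleGraph.mem_edgeSet, Sym2.mem_iff, Finset.coe_image,
        Set.mem_image, SetLike.mem_coe, Finset.mem_offDiag, Prod.exists, Function.uncurry_apply_pair]
      constructor
      · rintro ⟨hab, h⟩
        exact ⟨a, b, ⟨h a (Or.inl rfl), h b (Or.inr rfl), hab.ne⟩, rfl⟩
      · rintro ⟨x, y, ⟨hx, hy, hxy⟩, he⟩
        have hadj := hH.isClique hx hy hxy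
        rcases Sym2.eq_iff.1 he with ⟨rfl, rfl⟩ | ⟨rfl, rfl⟩
        · exact ⟨hadj, by rintro v (rfl | rfl) <;> assumption⟩
        · exact ⟨hadj.symm, by rintro v (rfl | rfl) <;> assumption⟩
  have hdisj : Disjoint {e : Sym2 V | e ∈ G.edgeSet ∧ ¬ ∀ v ∈ e, v ∈ H}
      {e : Sym2 V | e ∈ G.edgeSet ∧ ∀ v ∈ e, v ∈ H} :=
    Set.disjoint_left.2 fun e h h' => h.2 h'.2
  have hunion : G.edgeSet = {e : Sym2 V | e ∈ G.edgeSet ∧ ¬ ∀ v ∈ e, v ∈ H} ∪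
      {e : Sym2 V | e ∈ G.edgeSet ∧ ∀ v ∈ e, v ∈ H} := by
    ext e
    simp only [Set.mem_union, Set.mem_ofPred_eq]
    tauto
  rw [hunion, Set.ncard_union_eq hdisj, hinner, Set.ncard_coe_finset, Sym2.card_image_offDiag,
    hH.card_eq]
  rfl

/-! ### The parametrization of the general position stress matrices -/

theorem mainTheorem3 {V : Type*} [Fintype V] (G : SimpleGraph V) (d : ℕ)
    (hG : IsVertexConnected G (d + 1)) (H : Finset V) (hH : G.IsNClique (d + 1) H) :
    IsIrreducibleZariski (matrixCoords '' Gstr G d) ∧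
    (d + 1).choose 2 ≤ G.edgeSet.ncard ∧
    Nat.card (OuterEdge G H) = G.edgeSet.ncard - (d + 1).choose 2 ∧
    HasRealDimension (matrixCoords '' Gstr G d) (G.edgeSet.ncard - (d + 1).choose 2) ∧
    ∃ (X : Set (OuterEdge G H → ℝ)) (ρ : (OuterEdge G H → ℝ) → Matrix V V ℝ),
      IsZariskiOpen X ∧ X.Nonempty ∧
      (∀ i j : V, IsRationalOn X (fun w => ρ w i j)) ∧
      Set.BijOn ρ X (Gstr G d) ∧
      ∀ w ∈ X, CarriesWeights w (ρ w) ∧ IsRubberBandStress d w (ρ w) := by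
  classical
  have hcount := hH.ncard_edgeSet
  have hcard : G.edgeSet.ncard - (d + 1).choose 2 = Nat.card (OuterEdge G H) := by omega
  obtain ⟨f, hf, hX⟩ := hG.exists_polynomial_generalWeights d.succ_pos hH.card_eq
  have hbij := bijOn_rubberBandMatrix hH
  have hrat := isRationalOn_rubberBandMatrix (G := G) (H := H)
  have himage : matrixCoords '' Gstr G d =
      (fun w => matrixCoords (rubberBandMatrix w)) '' generalWeights G H := by
    rw [← hbij.image_eq, Set.image_image]
  have hne : (generalWeights G H).Nonempty := by
    obtain ⟨w, hw⟩ := MvPolynomial.exists_eval_ne_zero hf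
    exact ⟨w, by rw [hX]; exact hw⟩
  refine ⟨?_, by omega, hcard.symm, ?_, generalWeights G H, rubberBandMatrix, ?_, hne, hrat, hbij,
    fun w hw => ⟨carriesWeights_rubberBandMatrix hw,
      isRubberBandStress_rubberBandMatrix hH.isClique hw⟩⟩
  · rw [himage, hX]
    exact isIrreducibleZariski_image hf fun ij => hX ▸ hrat ij.1 ij.2
  · let π : (V × V → ℝ) →ₗ[ℝ] (OuterEdge G H → ℝ) :=
      weightsOf G H ∘ₗ (LinearEquiv.curry ℝ ℝ V V).toLinearMap
    have hopen : IsOpen (generalWeights G H) := by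
      rw [hX]
      exact isOpen_ne_fun f.contDiff_eval.continuous continuous_const
    have h := hasRealDimension_image_of_section (π := LinearMap.toContinuousLinearMap π)
      (ρ := fun w => matrixCoords (rubberBandMatrix w)) hopen hne
      (contDiffOn_pi.2 fun ij => (hrat ij.1 ij.2).contDiffOn)
      (fun w hw => weightsOf_rubberBandMatrix hH.isClique hw)
      (fun w => by
        obtain ⟨Ω, hΩ⟩ := surjective_weightsOf (G := G) (H := H) w
        exact ⟨matrixCoords Ω, hΩ⟩)
    rw [himage, hcard, Nat.card_eq_fintype_card, ← Module.finrank_fintype_fun_eq_card ℝ]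
    exact h
  · rw [hX]
    exact isZariskiOpen_setOf_eval_ne_zero f
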